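/- Let $D\ge 2$ be an integer. For a nonempty open, bounded, convex set $\Omega\subset\mathbb{R}^D$ put $$\delta(\Omega):=\frac{1}{|\Omega|}\int_\Omega \operatorname{dist}(x,\partial\Omega)\,dx ,$$ where $|\Omega|$ is the Lebesgue measure, and for $r>0$ let $\mathcal P^D[r]$ be the family of all such $\Omega$ with $\delta(\Omega)=r$. For $p\in(1,\infty)$ let $u_p\in W^{1,p}_0(\Omega)$ be the unique weak solution of $-\operatorname{div}(|\nabla u|^{p-2}\nabla u)=1$ in $\Omega$, $u=0$ on $\partial\Omega$, and put $$T_p(\Omega):=\int_\Omega u_p\,dx,\qquad T(p;\Omega):=|\Omega|^{p-1}\,T_p(\Omega)^{1-p}.$$ Then there is a constant $\overline\gamma_D\in\left[\frac{2}{D(D+1)},1\right)$, depending only on $D$, such that the following holds for all real numbers $0<a<b$. (i) If $\overline\gamma_D\,b<a$, then there exist a real number $q_D\in(1,\infty)$ and sets $\Omega_a\in\mathcal P^D[a]$, $\Omega_b\in\mathcal P^D[b]$ with $T(q_D;\Omega_a)<T(q_D;\Omega_b)$. (ii) If $\overline\gamma_D\,b\ge a$, then $T(p;\Omega_b)\le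 T(p;\Omega_a)$ for all $\Omega_a\in\mathcal P^D[a]$, all $\Omega_b\in\mathcal P^D[b]$ and all $p\in(1,\infty)$; if $\overline\gamma_D\,b>a$, then this inequality is strict for all such $\Omega_a$, $\Omega_b$ and $p$. -/

import Mathlib

open MeasureTheory Filter Topology
open scoped ContDiff Gradient

namespace PTorsion

/-- Open, bounded, convex (nonempty) domains of `ℝ^D`. -/
structure IsConvexDomain {D : ℕ} (Ω : Set (EuclideanSpace ℝ (Fin D))) : Prop where
  nonempty : Ω.Nonempty
  isOpen : IsOpen Ω
  isBounded : Bornology.IsBounded Ω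
  convex : Convex ℝ Ω

/-- The average over `Ω` of the distance to the boundary of `Ω`. -/
noncomputable def avgDist {D : ℕ} (Ω : Set (EuclideanSpace ℝ (Fin D))) : ℝ :=
  (volume.real Ω)⁻¹ * ∫ x in Ω, Metric.infDist x (frontier Ω)

/-- The convex domains whose average distance to the boundary equals `r`. -/
def domainsWithAvgDist (D : ℕ) (r : ℝ) : Set (Set (EuclideanSpace ℝ (Fin D))) :=
  {Ω | IsConvexDomain Ω ∧ avgDist Ω = r}

/-- Test functions: the space `C_c^∞(Ω)`. -/
structure IsTestFunction {D : ℕ} (Ω : Set (EuclideanSpace ℝ (Fin D)))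
    (φ : EuclideanSpace ℝ (Fin D) → ℝ) : Prop where
  contDiff : ContDiff ℝ ∞ φ
  hasCompactSupport : HasCompactSupport φ
  tsupport_subset : tsupport φ ⊆ Ω

/-- `G` is the weak (distributional) gradient of `u` in `Ω`. -/
def HasWeakGradient {D : ℕ} (Ω : Set (EuclideanSpace ℝ (Fin D)))
    (u : EuclideanSpace ℝ (Fin D) → ℝ)
    (G : EuclideanSpace ℝ (Fin D) → EuclideanSpace ℝ (Fin D)) : Prop :=
  ∀ φ : EuclideanSpace ℝ (Fin D) → ℝ, IsTestFunction Ω φ →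
    ∫ x in Ω, u x • ∇ φ x = -∫ x in Ω, φ x • G x

/-- `u ∈ W^{1,p}(Ω)`, with weak gradient `G`. -/
structure MemSobolev {D : ℕ} (p : ℝ) (Ω : Set (EuclideanSpace ℝ (Fin D)))
    (u : EuclideanSpace ℝ (Fin D) → ℝ)
    (G : EuclideanSpace ℝ (Fin D) → EuclideanSpace ℝ (Fin D)) : Prop where
  memLp : MemLp u (ENNReal.ofReal p) (volume.restrict Ω)
  memLp_grad : MemLp G (ENNReal.ofReal p) (volume.restrict Ω)
  hasWeakGradient : HasWeakGradient Ω u G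

/-- `u ∈ W_0^{1,p}(Ω)`, with weak gradient `G`: `u` lies in the closure of `C_c^∞(Ω)` in
`W^{1,p}(Ω)`. -/
structure MemSobolevZero {D : ℕ} (p : ℝ) (Ω : Set (EuclideanSpace ℝ (Fin D)))
    (u : EuclideanSpace ℝ (Fin D) → ℝ)
    (G : EuclideanSpace ℝ (Fin D) → EuclideanSpace ℝ (Fin D)) : Prop where
  memSobolev : MemSobolev p Ω u G
  approx : ∃ φ : ℕ → EuclideanSpace ℝ (Fin D) → ℝ, (∀ n, IsTestFunction Ω (φ n)) ∧
    Tendsto (fun n => eLpNorm (fun x => φ n x - u x) (ENNReal.ofReal p) (volume.restrict Ω))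
      atTop (𝓝 0) ∧
    Tendsto (fun n => eLpNorm (fun x => ∇ (φ n) x - G x) (ENNReal.ofReal p) (volume.restrict Ω))
      atTop (𝓝 0)

/-- `u ∈ W_0^{1,p}(Ω)` is a weak solution of `-div (|∇u|^{p-2} ∇u) = 1` in `Ω`, `u = 0` on
`∂Ω`. -/
def IsTorsionFunction {D : ℕ} (p : ℝ) (Ω : Set (EuclideanSpace ℝ (Fin D)))
    (u : EuclideanSpace ℝ (Fin D) → ℝ) : Prop :=
  ∃ G : EuclideanSpace ℝ (Fin D) → EuclideanSpace ℝ (Fin D), MemSobolevZero p Ω u G ∧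
    ∀ φ : EuclideanSpace ℝ (Fin D) → ℝ, IsTestFunction Ω φ →
      ∫ x in Ω, ‖G x‖ ^ (p - 2) * inner ℝ (G x) (∇ φ x) = ∫ x in Ω, φ x

open Classical in
/-- The `p`-torsion function of `Ω`. The weak solution exists and is unique up to null sets for
every convex domain and every `p > 1`; outside that setting the default value is `0`. -/
noncomputable def torsionFunction {D : ℕ} (p : ℝ) (Ω : Set (EuclideanSpace ℝ (Fin D))) :
    EuclideanSpace ℝ (Fin D) → ℝ :=
  if h : ∃ u, IsTorsionFunction p Ω u then h.choose else 0

/-- The `p`-torsional rigidity `T_p(Ω) = ∫_Ω u_p`. -/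
noncomputable def torsionalRigidity {D : ℕ} (p : ℝ) (Ω : Set (EuclideanSpace ℝ (Fin D))) : ℝ :=
  ∫ x in Ω, torsionFunction p Ω x

/-- The normalized `p`-torsional rigidity `T(p; Ω) = |Ω|^{p-1} T_p(Ω)^{1-p}`. -/
noncomputable def normalizedRigidity {D : ℕ} (p : ℝ) (Ω : Set (EuclideanSpace ℝ (Fin D))) : ℝ :=
  volume.real Ω ^ (p - 1) * torsionalRigidity p Ω ^ (1 - p)

end PTorsion

open scoped Pointwise

namespace PTorsion

/-! Put `S(p, Ω) = δ(Ω) T(p; Ω) ^ (1 / p)`, which is `scaledRigidity`. It is invariant under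
dilations, and `T(p; Ω) = (S(p, Ω) / δ(Ω)) ^ p`. Hence `T(p; Ω_b) ≤ T(p; Ω_a)` means `a / b ≤ S(p,
Ω_a) / S(p, Ω_b)`. Any convex domain can be dilated to any prescribed average distance, so the sharp
threshold is the infimum of these quotients over all `p` and all pairs of domains. Both parts of the
theorem then follow from the definition of an infimum; what remains is to bound this infimum.

All estimates use the variational meaning of the torsion (`IsTorsionFunction.variational`): `T_p ^
(1 - 1 / p)` is the best constant `M` in `|∫ ψ| ≤ M ‖∇ψ‖_p` over test functions. Weak solutions
exist by the direct method (`exists_isTorsionFunction`).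

From below: `S ≥ 1 / (D + 1)`. The `L¹` Poincaré inequality on a convex set holds with the inradius
as constant (`lintegral_enorm_le_inradius_mul`), and the inradius is at most `(D + 1) δ`
(`infDist_le_mul_avgDist`). From above: `S ≤ 1`, by using the distance to the boundary as a
competitor (`scaledRigidity_le_one`). So every quotient is at least `1 / (D + 1) ≥ 2 / (D (D + 1))`.

The infimum is below `1` because `S` is not constant. At `p = 20 / 19` the unit ball has `S ≥ D / (D
+ 1) ≥ 2 / 3` (`le_scaledRigidity_ball`), while a thin box has `S < 2 / 3`
(`exists_scaledRigidity_lt`). -/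

lemma subset_of_disjoint_frontier {X : Type*} [TopologicalSpace X] {Ω P : Set X} (hΩ : IsOpen Ω)
    (hP : IsPreconnected P) (hPf : Disjoint P (frontier Ω)) (hne : (P ∩ Ω).Nonempty) : P ⊆ Ω := by
  refine hP.subset_left_of_subset_union hΩ isClosed_closure.isOpen_compl
    (Set.disjoint_compl_right_iff_subset.2 subset_closure) (fun x hx => ?_) hne
  by_cases hxc : x ∈ closure Ω
  · rw [closure_eq_self_union_frontier] at hxc
    exact hxc.elim Or.inl fun h => (Set.disjoint_left.1 hPf hx h).elim
  · exact Or.inr hxc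

lemma le_infDist_frontier {X : Type*} [PseudoMetricSpace X] {Ω : Set X} (hΩ : IsOpen Ω)
    (hfr : (frontier Ω).Nonempty) {x : X} {r : ℝ} (h : Metric.ball x r ⊆ Ω) :
    r ≤ Metric.infDist x (frontier Ω) := by
  rw [Metric.le_infDist hfr]
  intro z hz
  by_contra hlt
  rw [not_le, dist_comm] at hlt
  exact Set.disjoint_left.1 (Set.disjoint_iff_inter_eq_empty.2 hΩ.inter_frontier_eq) (h hlt) hz

/-! ### Polyhedral approximation of convex domains -/

section Separation

variable {E : Type*} [NormedAddCommGroup E] [InnerProductSpace ℝ E] [FiniteDimensional ℝ E]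

/-- A compact convex subset of a bounded open set `Ω` is separated from the frontier of `Ω` by
finitely many half-spaces. -/
lemma exists_halfSpaces {Ω K : Set E} (hΩo : IsOpen Ω) (hΩb : Bornology.IsBounded Ω)
    (hK : IsCompact K) (hKc : Convex ℝ K) (hKne : K.Nonempty) (hKΩ : K ⊆ Ω) :
    ∃ (m : ℕ) (n : Fin m → E) (c : Fin m → ℝ), (∀ i, ‖n i‖ = 1) ∧
      (∀ x ∈ K, ∀ i, inner ℝ (n i) x < c i) ∧ ∀ x, (∀ i, inner ℝ (n i) x < c i) → x ∈ Ω := by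
  have hsep : ∀ y : frontier Ω, ∃ (n : E) (c : ℝ), ‖n‖ = 1 ∧ (∀ x ∈ K, inner ℝ n x < c) ∧
      c < inner ℝ n (y : E) := by
    rintro ⟨y, hy⟩
    have hyΩ : y ∉ Ω := fun h => Set.disjoint_left.1 (Set.disjoint_iff_inter_eq_empty.2 hΩo.inter_frontier_eq) h hy
    obtain ⟨f, u, w, h1, h2, h3⟩ := geometric_hahn_banach_compact_closed hKc hK
      (convex_singleton y) isClosed_singleton (Set.disjoint_singleton_right.2 fun h => hyΩ (hKΩ h))
    set g := (InnerProductSpace.toDual ℝ E).symm f with hg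
    have hgf : ∀ x, inner ℝ g x = f x := fun x => InnerProductSpace.toDual_symm_apply
    have h3 := h3 y rfl
    have hg0 : g ≠ 0 := by
      intro h0
      obtain ⟨x, hx⟩ := hKne
      have h1 := h1 x hx
      rw [← hgf, h0, inner_zero_left] at h1 h3
      linarith
    have hgn : 0 < ‖g‖ := norm_pos_iff.2 hg0
    refine ⟨‖g‖⁻¹ • g, ‖g‖⁻¹ * u, ?_, fun x hx => ?_, ?_⟩
    · rw [norm_smul, norm_inv, norm_norm, inv_mul_cancel₀ hgn.ne']
    · rw [real_inner_smul_left, hgf]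
      exact mul_lt_mul_of_pos_left (h1 x hx) (inv_pos.2 hgn)
    · rw [real_inner_smul_left, hgf]
      exact mul_lt_mul_of_pos_left (h2.trans h3) (inv_pos.2 hgn)
  choose n c hn hnK hny using hsep
  have hfc : IsCompact (frontier Ω) := by
    refine Metric.isCompact_of_isClosed_isBounded isClosed_frontier ?_
    exact hΩb.closure.subset frontier_subset_closure
  -- By compactness finitely many half-spaces already exclude the whole frontier. Their intersection
  -- is convex, hence connected, and it meets `Ω`, so it cannot leave `Ω`.
  obtain ⟨T, hT⟩ := hfc.elim_finite_subcover (fun y : frontier Ω => {z : E | c y < inner ℝ (n y) z})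
    (fun y => isOpen_lt continuous_const (by fun_prop))
    (fun z hz => Set.mem_iUnion.2 ⟨⟨z, hz⟩, hny ⟨z, hz⟩⟩)
  refine ⟨T.card, fun i => n (T.equivFin.symm i), fun i => c (T.equivFin.symm i),
    fun i => hn _, fun x hx i => hnK _ x hx, ?_⟩
  set P : Set E := {x | ∀ i, inner ℝ (n (T.equivFin.symm i)) x < c (T.equivFin.symm i)} with hP
  have hPc : Convex ℝ P := by
    have : P = ⋂ i, {x | inner ℝ (n (T.equivFin.symm i)) x < c (T.equivFin.symm i)} := by
      ext x; simp [hP]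
    rw [this]
    refine convex_iInter fun i => ?_
    exact convex_halfSpace_lt (f := fun x => inner ℝ (n (T.equivFin.symm i)) x)
      (innerSL ℝ (n (T.equivFin.symm i))).toLinearMap.isLinear _
  have hPf : Disjoint P (frontier Ω) := by
    rw [Set.disjoint_left]
    intro x hx hxf
    obtain ⟨y, hy, hxy⟩ := Set.mem_iUnion₂.1 (hT hxf)
    have := hx (T.equivFin ⟨y, hy⟩)
    rw [Equiv.symm_apply_apply] at this
    exact lt_asymm this hxy
  obtain ⟨k, hk⟩ := hKne
  have hkP : k ∈ P := fun i => hnK _ k hk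
  exact subset_of_disjoint_frontier hΩo hPc.isPreconnected hPf ⟨k, hkP, hKΩ hk⟩

/-- A compact subset of a bounded open convex set `Ω` lies in a compact convex subset of `Ω`. -/
lemma exists_isCompact_convex_between {Ω S : Set E} (hΩo : IsOpen Ω)
    (hΩb : Bornology.IsBounded Ω) (hΩc : Convex ℝ Ω) (hS : IsCompact S) (hSΩ : S ⊆ Ω) :
    ∃ K, IsCompact K ∧ Convex ℝ K ∧ S ⊆ K ∧ K ⊆ Ω := by
  obtain ⟨r, hr, hrΩ⟩ := hS.exists_cthickening_subset_open hΩo hSΩ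
  -- The erosion of `closure Ω` by a ball. Taking the closure makes it compact, and each of its
  -- points is interior to `closure Ω`, hence in `Ω` by convexity.
  set K : Set E := ⋂ w ∈ Metric.closedBall (0 : E) r, (fun x => x + w) ⁻¹' closure Ω with hKdef
  have hKcl : K ⊆ closure Ω := by
    intro x hx
    have := Set.mem_iInter₂.1 hx 0 (Metric.mem_closedBall_self hr.le)
    simpa using this
  refine ⟨K, Metric.isCompact_of_isClosed_isBounded ?_ (hΩb.closure.subset hKcl), ?_, ?_, ?_⟩
  · exact isClosed_biInter fun w _ => isClosed_closure.preimage (by fun_prop)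
  · exact convex_iInter₂ fun w _ => hΩc.closure.translate_preimage_left w
  · intro x hx
    refine Set.mem_iInter₂.2 fun w hw => subset_closure (hrΩ ?_)
    refine Metric.mem_cthickening_of_dist_le _ x _ _ hx ?_
    simpa [dist_eq_norm] using hw
  · intro x hx
    have hxi : x ∈ interior (closure Ω) := by
      refine mem_interior.2 ⟨Metric.ball x r, fun z hz => ?_, Metric.isOpen_ball,
        Metric.mem_ball_self hr⟩
      have hz' : z - x ∈ Metric.closedBall (0 : E) r := by
        rw [mem_closedBall_zero_iff, ← dist_eq_norm]; exact (Metric.mem_ball.1 hz).le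
      simpa using Set.mem_iInter₂.1 hx (z - x) hz'
    rwa [hΩc.interior_closure_eq_interior_of_nonempty_interior, hΩo.interior_eq] at hxi
    rw [hΩo.interior_eq]
    exact closure_nonempty_iff.1 ⟨x, hKcl hx⟩

end Separation

/-! ### The `L¹` Poincaré inequality with the inradius -/

section Poincare

variable {E : Type*} [NormedAddCommGroup E] [InnerProductSpace ℝ E] [FiniteDimensional ℝ E]
  [MeasurableSpace E] [BorelSpace E]

/-- One-dimensional Poincaré inequality along a fixed direction, integrated over a set in which
every point is joined to a zero of `v` by a segment of length at most `R` in that direction. -/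
lemma setLIntegral_enorm_le_of_segments {v : E → ℝ} (hv : ContDiff ℝ 1 v) {A : Set E}
    (hA : MeasurableSet A) {n : E} (hn : ‖n‖ = 1) {R : ℝ} {t : E → ℝ}
    (ht0 : ∀ x ∈ A, 0 ≤ t x) (htR : ∀ x ∈ A, t x ≤ R) (hzero : ∀ x ∈ A, v (x + t x • n) = 0)
    (hseg : ∀ x ∈ A, ∀ s, 0 ≤ s → s < t x → x + s • n ∈ A) :
    ∫⁻ x in A, ‖v x‖ₑ ≤ ENNReal.ofReal R * ∫⁻ x in A, ‖fderiv ℝ v x‖ₑ := by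
  have hcont : Continuous (fderiv ℝ v) := hv.continuous_fderiv (by norm_num)
  set f : E → ENNReal := A.indicator fun x => ‖fderiv ℝ v x‖ₑ with hf
  have hfm : Measurable f := (hcont.enorm.measurable).indicator hA
  have hpt : ∀ x ∈ A, ‖v x‖ₑ ≤ ∫⁻ s in Set.Ioc 0 R, f (x + s • n) := by
    intro x hx
    have hder : ∀ s : ℝ, HasDerivAt (fun s : ℝ => v (x + s • n)) (fderiv ℝ v (x + s • n) n) s := by
      intro s
      have h1 : HasDerivAt (fun s : ℝ => x + s • n) n s := by
        simpa using ((hasDerivAt_id s).smul_const n).const_add x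
      exact ((hv.differentiable (by norm_num) _).hasFDerivAt).comp_hasDerivAt s h1
    have hc : Continuous fun s : ℝ => fderiv ℝ v (x + s • n) n := by fun_prop
    have hint := intervalIntegral.integral_eq_sub_of_hasDerivAt (a := 0) (b := t x)
      (fun s _ => hder s) (hc.intervalIntegrable _ _)
    simp only [hzero x hx, zero_smul, add_zero, zero_sub] at hint
    calc ‖v x‖ₑ = ‖∫ s in (0 : ℝ)..t x, fderiv ℝ v (x + s • n) n‖ₑ := by rw [hint, enorm_neg]
      _ ≤ ∫⁻ s in Set.Ioc 0 (t x), ‖fderiv ℝ v (x + s • n) n‖ₑ := by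
          rw [intervalIntegral.integral_of_le (ht0 x hx)]
          exact enorm_integral_le_lintegral_enorm _
      -- `hseg` says nothing about the endpoint `s = t x`, so the interval has to be open there.
      _ = ∫⁻ s in Set.Ico 0 (t x), ‖fderiv ℝ v (x + s • n) n‖ₑ :=
          (setLIntegral_congr Ico_ae_eq_Ioc).symm
      _ ≤ ∫⁻ s in Set.Ico 0 (t x), f (x + s • n) := by
          refine setLIntegral_mono' measurableSet_Ico fun s hs => ?_
          rw [hf, Set.indicator_of_mem (hseg x hx s hs.1 hs.2), enorm_le_iff_norm_le]
          simpa [hn] using (fderiv ℝ v (x + s • n)).le_opNorm n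
      _ ≤ ∫⁻ s in Set.Ico 0 R, f (x + s • n) :=
          lintegral_mono_set (Set.Ico_subset_Ico_right (htR x hx))
      _ = ∫⁻ s in Set.Ioc 0 R, f (x + s • n) := setLIntegral_congr Ico_ae_eq_Ioc
  -- After Tonelli, translation invariance makes the inner integral independent of `s`; this is why
  -- `f` was extended by zero to the whole space.
  calc ∫⁻ x in A, ‖v x‖ₑ ≤ ∫⁻ x in A, ∫⁻ s in Set.Ioc 0 R, f (x + s • n) :=
        setLIntegral_mono' hA hpt
    _ ≤ ∫⁻ x, ∫⁻ s in Set.Ioc 0 R, f (x + s • n) := setLIntegral_le_lintegral _ _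
    _ = ∫⁻ s in Set.Ioc 0 R, ∫⁻ x, f (x + s • n) := by
        refine lintegral_lintegral_swap (Measurable.aemeasurable ?_)
        exact hfm.comp (by fun_prop)
    _ = ENNReal.ofReal R * ∫⁻ x in A, ‖fderiv ℝ v x‖ₑ := by
        simp_rw [lintegral_add_right_eq_self f]
        rw [lintegral_const, Measure.restrict_apply_univ, Real.volume_Ioc, sub_zero, hf,
          lintegral_indicator hA, mul_comm]

/-- The `L¹` Poincaré inequality on a bounded open convex set, with the inradius as constant. -/
lemma lintegral_enorm_le_inradius_mul {Ω : Set E} (hΩo : IsOpen Ω)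
    (hΩb : Bornology.IsBounded Ω) (hΩc : Convex ℝ Ω) (hfr : (frontier Ω).Nonempty)
    {R : ℝ} (hR : ∀ x ∈ Ω, Metric.infDist x (frontier Ω) ≤ R) {v : E → ℝ}
    (hv : ContDiff ℝ 1 v) (hvc : HasCompactSupport v) (hvs : tsupport v ⊆ Ω) :
    ∫⁻ x, ‖v x‖ₑ ≤ ENNReal.ofReal R * ∫⁻ x, ‖fderiv ℝ v x‖ₑ := by
  rcases (tsupport v).eq_empty_or_nonempty with h0 | hne
  · have : v = 0 := tsupport_eq_empty_iff.1 h0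
    simp [this]
  obtain ⟨K, hKc, hKco, hvK, hKΩ⟩ := exists_isCompact_convex_between hΩo hΩb hΩc hvc hvs
  obtain ⟨m, n, c, hn, hK, hP⟩ := exists_halfSpaces hΩo hΩb hKc hKco (hne.mono hvK) hKΩ
  set l : Fin m → E → ℝ := fun i x => c i - inner ℝ (n i) x with hl
  have hlm : ∀ i, Measurable (l i) := fun i => by
    have : Continuous (l i) := by simp only [hl]; fun_prop
    exact this.measurable
  -- Cell of the points of the polyhedron whose nearest face has index `i`. Ties go to the smallest
  -- index, so that the cells are disjoint.
  set A : Fin m → Set E := fun i => {x | (∀ j, 0 < l j x) ∧ (∀ j, j < i → l i x < l j x) ∧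
    ∀ j, l i x ≤ l j x} with hA
  have hAm : ∀ i, MeasurableSet (A i) := by
    intro i
    refine MeasurableSet.inter ?_ (MeasurableSet.inter ?_ ?_)
    · exact measurableSet_setOfPred.2 (Measurable.forall fun j =>
        measurableSet_setOfPred.1 (measurableSet_lt measurable_const (hlm j)))
    · exact measurableSet_setOfPred.2 (Measurable.forall fun j => Measurable.imp measurable_const
        (measurableSet_setOfPred.1 (measurableSet_lt (hlm i) (hlm j))))
    · exact measurableSet_setOfPred.2 (Measurable.forall fun j =>
        measurableSet_setOfPred.1 (measurableSet_le (hlm i) (hlm j)))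
  have hAd : Pairwise (Function.onFun Disjoint A) := by
    intro i j hij
    rw [Function.onFun, Set.disjoint_left]
    rintro x ⟨-, h1, h2⟩ ⟨-, h3, h4⟩
    rcases lt_or_gt_of_ne hij with h | h
    · exact absurd (h3 i h) (not_lt.2 (h2 j))
    · exact absurd (h1 j h) (not_lt.2 (h4 i))
  have hvl : ∀ x i, l i x ≤ 0 → v x = 0 := by
    intro x i hx
    by_contra h
    have := hK x (hvK (subset_tsupport v h)) i
    simp only [hl] at hx
    linarith
  have hm : Nonempty (Fin m) := by
    by_contra hmt
    rw [not_nonempty_iff] at hmt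
    obtain ⟨z, hz⟩ := hfr
    exact Set.disjoint_left.1 (Set.disjoint_iff_inter_eq_empty.2 hΩo.inter_frontier_eq) (hP z fun i => hmt.elim i) hz
  have hcover : ∀ x, v x ≠ 0 → x ∈ ⋃ i, A i := by
    intro x hx
    have hpos : ∀ j, 0 < l j x := fun j => not_le.1 fun h => hx (hvl x j h)
    obtain ⟨i0, hi0⟩ := Finite.exists_min fun j => l j x
    obtain ⟨i, hi, hmin⟩ := WellFounded.has_min (wellFounded_lt (α := Fin m))
      {i | ∀ j, l i x ≤ l j x} ⟨i0, hi0⟩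
    refine Set.mem_iUnion.2 ⟨i, hpos, fun j hj => ?_, hi⟩
    by_contra hle
    exact hmin j (fun k => (not_lt.1 hle).trans (hi k)) hj
  have hstep : ∀ (i j : Fin m) (x : E) (s : ℝ), l j (x + s • n i) =
      l j x - s * inner ℝ (n j) (n i) := by
    intro i j x s
    simp only [hl, inner_add_right, real_inner_smul_right]; ring
  have hnn : ∀ i j : Fin m, inner ℝ (n j) (n i) ≤ (1 : ℝ) := by
    intro i j
    have := real_inner_le_norm (n j) (n i)
    simpa [hn] using this
  have hself : ∀ i, inner ℝ (n i) (n i) = (1 : ℝ) := by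
    intro i; rw [real_inner_self_eq_norm_sq, hn]; norm_num
  have hcell : ∀ i, ∫⁻ x in A i, ‖v x‖ₑ ≤ ENNReal.ofReal R * ∫⁻ x in A i, ‖fderiv ℝ v x‖ₑ := by
    intro i
    refine setLIntegral_enorm_le_of_segments hv (hAm i) (hn i) (t := l i)
      (fun x hx => (hx.1 i).le) (fun x hx => ?_) (fun x hx => ?_) fun x hx s hs0 hs => ?_
    -- The segment runs along the normal to face `i` and has length `l i x`, the distance to the
    -- nearest face. The ball of that radius lies in the polyhedron, so the length is at most the
    -- inradius.
    · refine le_trans ?_ (hR x (hP x fun j => by simpa [hl] using hx.1 j))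
      refine le_infDist_frontier hΩo hfr fun z hz => hP z fun j => ?_
      have hlt : dist x z < l i x := by rw [dist_comm]; exact hz
      have h1 : inner ℝ (n j) (z - x) ≤ dist x z := by
        have := real_inner_le_norm (n j) (z - x)
        rwa [hn, one_mul, ← dist_eq_norm, dist_comm] at this
      rw [inner_sub_right] at h1
      have := hx.2.2 j
      simp only [hl] at this hlt
      linarith
    · exact hvl _ i (by rw [hstep, hself]; simp)
    -- Along the segment `l i` decreases at unit rate and every other `l j` at no greater rate, so
    -- face `i` stays nearest and the cell is not left.
    · have hi : l i (x + s • n i) = l i x - s := by rw [hstep, hself, mul_one]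
      have hj : ∀ j, l j x - s ≤ l j (x + s • n i) := by
        intro j
        rw [hstep]
        have := mul_le_mul_of_nonneg_left (hnn i j) hs0
        linarith
      refine ⟨fun j => ?_, fun j hji => ?_, fun j => ?_⟩
      · have := hj j; have := hx.2.2 j; linarith
      · have := hj j; have := hx.2.1 j hji; rw [hi]; linarith
      · have := hj j; have := hx.2.2 j; rw [hi]; linarith
  have hUm : MeasurableSet (⋃ i, A i) := MeasurableSet.iUnion hAm
  calc ∫⁻ x, ‖v x‖ₑ = ∫⁻ x in ⋃ i, A i, ‖v x‖ₑ := by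
        rw [← lintegral_indicator hUm]
        refine lintegral_congr fun x => ?_
        by_cases hx : x ∈ ⋃ i, A i
        · rw [Set.indicator_of_mem hx]
        · rw [Set.indicator_of_notMem hx, not_not.1 fun h => hx (hcover x h), enorm_zero]
    _ = ∑' i, ∫⁻ x in A i, ‖v x‖ₑ := lintegral_iUnion hAm hAd _
    _ ≤ ∑' i, ENNReal.ofReal R * ∫⁻ x in A i, ‖fderiv ℝ v x‖ₑ := ENNReal.tsum_le_tsum hcell
    _ = ENNReal.ofReal R * ∫⁻ x in ⋃ i, A i, ‖fderiv ℝ v x‖ₑ := by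
        rw [ENNReal.tsum_mul_left, lintegral_iUnion hAm hAd]
    _ ≤ _ := by exact mul_le_mul_right (setLIntegral_le_lintegral _ _) _

lemma integral_abs_le_inradius_mul {Ω : Set E} (hΩo : IsOpen Ω)
    (hΩb : Bornology.IsBounded Ω) (hΩc : Convex ℝ Ω) (hfr : (frontier Ω).Nonempty)
    {R : ℝ} (hR0 : 0 ≤ R) (hR : ∀ x ∈ Ω, Metric.infDist x (frontier Ω) ≤ R) {v : E → ℝ}
    (hv : ContDiff ℝ 1 v) (hvc : HasCompactSupport v) (hvs : tsupport v ⊆ Ω) :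
    ∫ x, |v x| ≤ R * ∫ x, ‖fderiv ℝ v x‖ := by
  have h := lintegral_enorm_le_inradius_mul hΩo hΩb hΩc hfr hR hv hvc hvs
  have hvi : Integrable v := hv.continuous.integrable_of_hasCompactSupport hvc
  have hdi : Integrable (fderiv ℝ v) :=
    (hv.continuous_fderiv (by norm_num)).integrable_of_hasCompactSupport (hvc.fderiv ℝ)
  have h1 : ∫ x, |v x| = (∫⁻ x, ‖v x‖ₑ).toReal := integral_norm_eq_lintegral_enorm hvi.1
  rw [h1, integral_norm_eq_lintegral_enorm hdi.1]
  have h2 := ENNReal.toReal_mono (ENNReal.mul_ne_top ENNReal.ofReal_ne_top hdi.2.ne) h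
  rwa [ENNReal.toReal_mul, ENNReal.toReal_ofReal hR0] at h2

end Poincare

/-! ### Uniform convexity of the power of the norm -/

section UniformConvexity

variable {E : Type*} [NormedAddCommGroup E] [InnerProductSpace ℝ E]

lemma norm_midpoint_rpow_le {p : ℝ} (hp : 1 < p) (a b : E) :
    2 * ‖(2⁻¹ : ℝ) • (a + b)‖ ^ p ≤ ‖a‖ ^ p + ‖b‖ ^ p := by
  have h1 : ‖(2⁻¹ : ℝ) • (a + b)‖ ≤ 2⁻¹ * ‖a‖ + 2⁻¹ * ‖b‖ := by
    rw [norm_smul, Real.norm_of_nonneg (by norm_num : (0 : ℝ) ≤ 2⁻¹)]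
    linarith [norm_add_le a b]
  have h2 := (convexOn_rpow hp.le).2 (norm_nonneg a) (norm_nonneg b)
    (by norm_num : (0 : ℝ) ≤ 2⁻¹) (by norm_num : (0 : ℝ) ≤ 2⁻¹) (by norm_num)
  simp only [smul_eq_mul] at h2
  have h3 := Real.rpow_le_rpow (norm_nonneg _) h1 (by linarith : 0 ≤ p)
  linarith

/-- Two sources of strictness: for equal norms, distinct vectors are not on a common ray and the
triangle inequality is strict; for different norms, `t ↦ t ^ p` is strictly convex. -/
lemma norm_midpoint_rpow_lt {p : ℝ} (hp : 1 < p) {a b : E} (hab : a ≠ b) :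
    2 * ‖(2⁻¹ : ℝ) • (a + b)‖ ^ p < ‖a‖ ^ p + ‖b‖ ^ p := by
  have hp0 : 0 < p := by linarith
  have e : ‖(2⁻¹ : ℝ) • (a + b)‖ = 2⁻¹ * ‖a + b‖ := by
    rw [norm_smul, Real.norm_of_nonneg (by norm_num : (0 : ℝ) ≤ 2⁻¹)]
  by_cases hn : ‖a‖ = ‖b‖
  · have hray : ¬ SameRay ℝ a b := fun h => hab ((sameRay_iff_of_norm_eq hn).1 h)
    have h1 : ‖(2⁻¹ : ℝ) • (a + b)‖ < ‖b‖ := by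
      rw [e]
      have := not_sameRay_iff_norm_add_lt.1 hray
      linarith
    have h3 := Real.rpow_lt_rpow (norm_nonneg _) h1 hp0
    rw [hn]; linarith
  · have h2 := (strictConvexOn_rpow hp).2 (norm_nonneg a) (norm_nonneg b) hn
      (by norm_num : (0 : ℝ) < 2⁻¹) (by norm_num : (0 : ℝ) < 2⁻¹) (by norm_num)
    simp only [smul_eq_mul] at h2
    have h1 : ‖(2⁻¹ : ℝ) • (a + b)‖ ≤ 2⁻¹ * ‖a‖ + 2⁻¹ * ‖b‖ := by
      rw [e]; linarith [norm_add_le a b]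
    have h3 := Real.rpow_le_rpow (norm_nonneg _) h1 hp0.le
    linarith

/-- Uniform convexity of `‖·‖ ^ p`, in a qualitative form that can be integrated. -/
lemma exists_norm_sub_rpow_le [FiniteDimensional ℝ E] {p : ℝ} (hp : 1 < p) {ε : ℝ} (hε : 0 < ε) :
    ∃ C, 0 ≤ C ∧ ∀ a b : E, ‖a - b‖ ^ p ≤
      C * (‖a‖ ^ p + ‖b‖ ^ p - 2 * ‖(2⁻¹ : ℝ) • (a + b)‖ ^ p) + ε * (‖a‖ ^ p + ‖b‖ ^ p) := by
  have hp0 : 0 < p := by linarith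
  set F : E × E → ℝ := fun z => ‖z.1‖ ^ p + ‖z.2‖ ^ p - 2 * ‖(2⁻¹ : ℝ) • (z.1 + z.2)‖ ^ p with hF
  have hFc : Continuous F := by
    have h1 : Continuous fun z : E × E => ‖z.1‖ ^ p :=
      (continuous_fst.norm).rpow_const fun _ => Or.inr hp0.le
    have h2 : Continuous fun z : E × E => ‖z.2‖ ^ p :=
      (continuous_snd.norm).rpow_const fun _ => Or.inr hp0.le
    have h3 : Continuous fun z : E × E => ‖(2⁻¹ : ℝ) • (z.1 + z.2)‖ ^ p :=
      Continuous.rpow_const (by fun_prop) fun _ => Or.inr hp0.le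
    exact (h1.add h2).sub (continuous_const.mul h3)
  have hDc : Continuous fun z : E × E => ‖z.1 - z.2‖ ^ p :=
    Continuous.rpow_const (by fun_prop) fun _ => Or.inr hp0.le
  -- By homogeneity it suffices to treat unit pairs. On the compact set where `‖a - b‖ ^ p ≥ ε` the
  -- convexity defect `F` has a positive minimum `m`; elsewhere the `ε` term suffices, since a unit
  -- pair for the sup norm has `‖a‖ ^ p + ‖b‖ ^ p ≥ 1`.
  set S : Set (E × E) := Metric.sphere 0 1 ∩ {z | ε ≤ ‖z.1 - z.2‖ ^ p} with hS
  have hSc : IsCompact S := (isCompact_sphere _ _).inter_right (isClosed_le continuous_const hDc)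
  have hFnn : ∀ a b : E, 0 ≤ F (a, b) := fun a b => by
    have := norm_midpoint_rpow_le hp a b
    simp only [hF]; linarith
  obtain ⟨m, hm, hmS⟩ : ∃ m, 0 < m ∧ ∀ z ∈ S, m ≤ F z := by
    rcases S.eq_empty_or_nonempty with h0 | hne
    · exact ⟨1, one_pos, by simp [h0]⟩
    · obtain ⟨z, hz, hmin⟩ := hSc.exists_isMinOn hne hFc.continuousOn
      refine ⟨F z, ?_, fun w hw => hmin hw⟩
      have hne : z.1 ≠ z.2 := by
        intro h
        have h2 : ε ≤ ‖z.1 - z.2‖ ^ p := hz.2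
        rw [h, sub_self, norm_zero, Real.zero_rpow hp0.ne'] at h2
        linarith
      have := norm_midpoint_rpow_lt hp hne
      simp only [hF]; linarith
  refine ⟨2 ^ p / m, by positivity, ?_⟩
  have hunit : ∀ z : E × E, ‖z‖ = 1 → ‖z.1 - z.2‖ ^ p ≤
      2 ^ p / m * F z + ε * (‖z.1‖ ^ p + ‖z.2‖ ^ p) := by
    intro z hz
    have hle : 1 ≤ ‖z.1‖ ^ p + ‖z.2‖ ^ p := by
      rw [Prod.norm_def] at hz
      rcases max_choice ‖z.1‖ ‖z.2‖ with h | h <;> rw [h] at hz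
      · rw [hz, Real.one_rpow]; have := Real.rpow_nonneg (norm_nonneg z.2) p; linarith
      · rw [hz, Real.one_rpow]; have := Real.rpow_nonneg (norm_nonneg z.1) p; linarith
    have hFz := hFnn z.1 z.2
    by_cases hzε : ε ≤ ‖z.1 - z.2‖ ^ p
    · have h1 : m ≤ F z := hmS z ⟨by simpa using hz, hzε⟩
      have h2 : ‖z.1 - z.2‖ ≤ 2 := by
        have h3 := norm_fst_le z
        have h4 := norm_snd_le z
        linarith [norm_sub_le z.1 z.2]
      have h3 := Real.rpow_le_rpow (norm_nonneg _) h2 hp0.le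
      have h4 : (2 : ℝ) ^ p ≤ 2 ^ p / m * F z := by
        rw [div_mul_eq_mul_div, le_div_iff₀ hm]
        exact mul_le_mul_of_nonneg_left h1 (by positivity)
      have h5 : 0 ≤ ε * (‖z.1‖ ^ p + ‖z.2‖ ^ p) := by positivity
      linarith
    · have h1 : ε ≤ ε * (‖z.1‖ ^ p + ‖z.2‖ ^ p) := le_mul_of_one_le_right hε.le hle
      have h2 : 0 ≤ 2 ^ p / m * F z := mul_nonneg (by positivity) hFz
      linarith
  intro a b
  by_cases h0 : ((a, b) : E × E) = 0
  · have ha : a = 0 := congrArg Prod.fst h0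
    have hb : b = 0 := congrArg Prod.snd h0
    simp [ha, hb, Real.zero_rpow hp0.ne']
  · set r := ‖((a, b) : E × E)‖ with hr
    have hr0 : 0 < r := norm_pos_iff.2 h0
    have h := hunit (r⁻¹ • (a, b)) (by rw [norm_smul, norm_inv, Real.norm_of_nonneg hr0.le,
      inv_mul_cancel₀ hr0.ne'])
    have hs : ∀ x : E, ‖r⁻¹ • x‖ ^ p = r⁻¹ ^ p * ‖x‖ ^ p := by
      intro x
      rw [norm_smul, Real.norm_of_nonneg (inv_nonneg.2 hr0.le),
        Real.mul_rpow (inv_nonneg.2 hr0.le) (norm_nonneg _)]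
    simp only [hF, Prod.smul_fst, Prod.smul_snd, ← smul_sub, ← smul_add, smul_comm (2⁻¹ : ℝ),
      hs] at h
    have hrp : 0 < r⁻¹ ^ p := by positivity
    refine le_of_mul_le_mul_left ?_ hrp
    linarith

end UniformConvexity

/-! ### Convex domains: average distance and inradius -/

namespace IsConvexDomain

variable {D : ℕ} {Ω : Set (EuclideanSpace ℝ (Fin D))}

lemma frontier_nonempty (h : IsConvexDomain Ω) (hD : 1 ≤ D) : (frontier Ω).Nonempty := by
  have : Nonempty (Fin D) := ⟨⟨0, hD⟩⟩
  rw [nonempty_frontier_iff]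
  refine ⟨h.nonempty, ?_⟩
  rintro rfl
  exact NormedSpace.unbounded_univ ℝ _ h.isBounded

lemma volume_ne_top (h : IsConvexDomain Ω) : volume Ω ≠ ⊤ := h.isBounded.measure_lt_top.ne

lemma volume_real_pos (h : IsConvexDomain Ω) : 0 < volume.real Ω :=
  ENNReal.toReal_pos (h.isOpen.measure_pos volume h.nonempty).ne' h.volume_ne_top

lemma ball_infDist_subset (h : IsConvexDomain Ω) {x : EuclideanSpace ℝ (Fin D)} (hx : x ∈ Ω) :
    Metric.ball x (Metric.infDist x (frontier Ω)) ⊆ Ω := by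
  rcases (Metric.infDist_nonneg (x := x) (s := frontier Ω)).eq_or_lt with h0 | h0
  · simp [← h0]
  · exact subset_of_disjoint_frontier h.isOpen (convex_ball _ _).isPreconnected
      Metric.disjoint_ball_infDist ⟨x, Metric.mem_ball_self h0, hx⟩

lemma infDist_pos (h : IsConvexDomain Ω) (hD : 1 ≤ D) {x : EuclideanSpace ℝ (Fin D)}
    (hx : x ∈ Ω) : 0 < Metric.infDist x (frontier Ω) := by
  refine (isClosed_frontier.notMem_iff_infDist_pos (h.frontier_nonempty hD)).1 fun hf => ?_
  exact Set.disjoint_left.1 (Set.disjoint_iff_inter_eq_empty.2 h.isOpen.inter_frontier_eq) hx hf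

lemma integrableOn_of_continuous (h : IsConvexDomain Ω) {F : Type*} [NormedAddCommGroup F]
    {f : EuclideanSpace ℝ (Fin D) → F} (hf : Continuous f) : IntegrableOn f Ω :=
  (hf.continuousOn.integrableOn_compact h.isBounded.isCompact_closure).mono_set subset_closure

lemma avgDist_pos (h : IsConvexDomain Ω) (hD : 1 ≤ D) : 0 < avgDist Ω := by
  refine mul_pos (inv_pos.2 h.volume_real_pos) ?_
  rw [setIntegral_pos_iff_support_of_nonneg_ae
    (Eventually.of_forall fun x => Metric.infDist_nonneg)
    (h.integrableOn_of_continuous (Metric.continuous_infDist_pt _))]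
  refine (h.isOpen.measure_pos volume h.nonempty).trans_le (measure_mono fun x hx => ⟨?_, hx⟩)
  exact (h.infDist_pos hD hx).ne'

/-- The distance to the boundary is concave, so its average is at least `1 / (D + 1)` of each of
its values. -/
lemma infDist_le_mul_avgDist (h : IsConvexDomain Ω) (hD : 1 ≤ D) {c : EuclideanSpace ℝ (Fin D)}
    (hc : c ∈ Ω) : Metric.infDist c (frontier Ω) ≤ (D + 1) * avgDist Ω := by
  set d := fun x : EuclideanSpace ℝ (Fin D) => Metric.infDist x (frontier Ω) with hd
  set R := d c with hR
  have hR0 : 0 < R := h.infDist_pos hD hc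
  have hV := h.volume_real_pos
  have hdc : Continuous d := Metric.continuous_infDist_pt _
  -- The level set `{d ≥ t}` contains the copy of `Ω` shrunk towards `c` by the factor `1 - t / R`.
  -- Integrating the volumes of these copies by the layer-cake formula produces the factor `1 / (D +
  -- 1)`.
  have hlevel : ∀ t ∈ Set.Ioc 0 R, ENNReal.ofReal ((1 - t / R) ^ D * volume.real Ω) ≤
      (volume.restrict Ω) {x | t ≤ d x} := by
    intro t ht
    have hs0 : 0 < t / R := div_pos ht.1 hR0
    have hs1 : 0 ≤ 1 - t / R := sub_nonneg.2 ((div_le_one hR0).2 ht.2)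
    have hsub : AffineMap.homothety c (1 - t / R) '' Ω ⊆ {x | t ≤ d x} ∩ Ω := by
      rintro _ ⟨x, hx, rfl⟩
      have hball : Metric.ball (AffineMap.homothety c (1 - t / R) x) t ⊆ Ω := by
        intro z hz
        -- A point within `t` of the shrunk image of `x` is a convex combination of `x` and a point
        -- of the ball of radius `R` about `c`.
        have hz2 : c + (t / R)⁻¹ • (z - AffineMap.homothety c (1 - t / R) x) ∈ Ω := by
          refine h.ball_infDist_subset hc ?_
          rw [Metric.mem_ball, dist_eq_norm, add_sub_cancel_left, norm_smul,
            Real.norm_of_nonneg (by positivity)]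
          rw [Metric.mem_ball, dist_eq_norm] at hz
          rw [inv_mul_lt_iff₀ hs0]
          have : t / R * Metric.infDist c (frontier Ω) = t := div_mul_cancel₀ _ hR0.ne'
          linarith
        have := h.convex hz2 hx hs0.le hs1 (by ring)
        convert this using 1
        rw [smul_add, smul_smul, mul_inv_cancel₀ hs0.ne', one_smul, AffineMap.homothety_apply,
          vsub_eq_sub, vadd_eq_add]
        module
      refine ⟨le_infDist_frontier h.isOpen (h.frontier_nonempty hD) hball, ?_⟩
      exact hball (Metric.mem_ball_self ht.1)
    rw [Measure.restrict_apply' h.isOpen.measurableSet]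
    refine le_trans (le_of_eq ?_) (measure_mono hsub)
    rw [Measure.addHaar_image_homothety, finrank_euclideanSpace_fin, abs_of_nonneg (by positivity),
      ENNReal.ofReal_mul (by positivity), Measure.real, ENNReal.ofReal_toReal h.volume_ne_top]
  have hint : ∫ t in (0 : ℝ)..R, (1 - t / R) ^ D * volume.real Ω =
      R / (D + 1) * volume.real Ω := by
    rw [intervalIntegral.integral_mul_const]
    congr 1
    have := intervalIntegral.integral_comp_sub_div (a := 0) (b := R) (fun x : ℝ => x ^ D)
      hR0.ne' (1 : ℝ)
    rw [this, zero_div, sub_zero, div_self hR0.ne', sub_self, integral_pow]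
    simp [div_eq_mul_inv]
  have hdi : IntegrableOn d Ω := h.integrableOn_of_continuous hdc
  have key : ENNReal.ofReal (R / (D + 1) * volume.real Ω) ≤ ENNReal.ofReal (∫ x in Ω, d x) := by
    rw [ofReal_integral_eq_lintegral_ofReal hdi (Eventually.of_forall fun x => Metric.infDist_nonneg),
      lintegral_eq_lintegral_meas_le _ (Eventually.of_forall fun x => Metric.infDist_nonneg)
        hdc.measurable.aemeasurable, ← hint, intervalIntegral.integral_of_le hR0.le,
      ofReal_integral_eq_lintegral_ofReal]
    · exact (setLIntegral_mono' measurableSet_Ioc hlevel).trans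
        (lintegral_mono_set Set.Ioc_subset_Ioi_self)
    · exact (Continuous.integrableOn_Ioc (by fun_prop))
    · refine (ae_restrict_iff' measurableSet_Ioc).2 (Eventually.of_forall fun t ht => ?_)
      have : 0 ≤ 1 - t / R := sub_nonneg.2 ((div_le_one hR0).2 ht.2)
      simp only [Pi.zero_apply]
      positivity
  have key2 := (ENNReal.ofReal_le_ofReal_iff (integral_nonneg fun x => Metric.infDist_nonneg)).1 key
  rw [avgDist, inv_mul_eq_div, mul_div_assoc', le_div_iff₀ hV]
  rw [div_mul_eq_mul_div, div_le_iff₀ (by positivity)] at key2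
  linarith

end IsConvexDomain

/-! ### Real-valued `L^p` norms and the `p`-energy -/

section PNorm

variable {α F : Type*} [MeasurableSpace α] {μ : Measure α} [NormedAddCommGroup F] {p : ℝ}

/-- The `L^p` norm as a real number. -/
noncomputable def pNorm (p : ℝ) (μ : Measure α) (f : α → F) : ℝ := (∫ x, ‖f x‖ ^ p ∂μ) ^ (1 / p)

lemma ofReal_ne_zero_of_one_lt (hp : 1 < p) : ENNReal.ofReal p ≠ 0 :=
  (ENNReal.ofReal_pos.2 (by linarith)).ne'

lemma one_le_ofReal_of_one_lt (hp : 1 < p) : 1 ≤ ENNReal.ofReal p := by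
  rw [← ENNReal.ofReal_one]; exact ENNReal.ofReal_le_ofReal hp.le

lemma integral_norm_rpow_nonneg (f : α → F) : 0 ≤ ∫ x, ‖f x‖ ^ p ∂μ :=
  integral_nonneg fun _ => Real.rpow_nonneg (norm_nonneg _) _

lemma pNorm_nonneg (f : α → F) : 0 ≤ pNorm p μ f :=
  Real.rpow_nonneg (integral_norm_rpow_nonneg f) _

lemma pNorm_rpow (hp : 1 < p) (f : α → F) : pNorm p μ f ^ p = ∫ x, ‖f x‖ ^ p ∂μ := by
  rw [pNorm, ← Real.rpow_mul (integral_norm_rpow_nonneg f), one_div_mul_cancel (by linarith),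
    Real.rpow_one]

lemma integrable_norm_rpow (hp : 1 < p) {f : α → F} (hf : MemLp f (ENNReal.ofReal p) μ) :
    Integrable (fun x => ‖f x‖ ^ p) μ := by
  have := hf.integrable_norm_rpow (ofReal_ne_zero_of_one_lt hp) ENNReal.ofReal_ne_top
  rwa [ENNReal.toReal_ofReal (by linarith)] at this

lemma eLpNorm_eq_ofReal_pNorm (hp : 1 < p) {f : α → F} (hf : MemLp f (ENNReal.ofReal p) μ) :
    eLpNorm f (ENNReal.ofReal p) μ = ENNReal.ofReal (pNorm p μ f) := by
  rw [hf.eLpNorm_eq_integral_rpow_norm (ofReal_ne_zero_of_one_lt hp) ENNReal.ofReal_ne_top,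
    ENNReal.toReal_ofReal (by linarith), pNorm, one_div]

lemma pNorm_eq_toReal (hp : 1 < p) {f : α → F} (hf : MemLp f (ENNReal.ofReal p) μ) :
    pNorm p μ f = (eLpNorm f (ENNReal.ofReal p) μ).toReal := by
  rw [eLpNorm_eq_ofReal_pNorm hp hf, ENNReal.toReal_ofReal (pNorm_nonneg f)]

lemma pNorm_add_le (hp : 1 < p) {f g : α → F} (hf : MemLp f (ENNReal.ofReal p) μ)
    (hg : MemLp g (ENNReal.ofReal p) μ) : pNorm p μ (f + g) ≤ pNorm p μ f + pNorm p μ g := by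
  rw [← ENNReal.ofReal_le_ofReal_iff (add_nonneg (pNorm_nonneg f) (pNorm_nonneg g)),
    ENNReal.ofReal_add (pNorm_nonneg f) (pNorm_nonneg g), ← eLpNorm_eq_ofReal_pNorm hp hf,
    ← eLpNorm_eq_ofReal_pNorm hp hg, ← eLpNorm_eq_ofReal_pNorm hp (hf.add hg)]
  exact eLpNorm_add_le hf.1 hg.1 (one_le_ofReal_of_one_lt hp)

lemma pNorm_sub_comm (f g : α → F) : pNorm p μ (f - g) = pNorm p μ (g - f) := by
  simp only [pNorm, Pi.sub_apply, norm_sub_rev]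

lemma abs_pNorm_sub_le (hp : 1 < p) {f g : α → F} (hf : MemLp f (ENNReal.ofReal p) μ)
    (hg : MemLp g (ENNReal.ofReal p) μ) : |pNorm p μ f - pNorm p μ g| ≤ pNorm p μ (f - g) := by
  have h1 := pNorm_add_le hp (hf.sub hg) hg
  have h2 := pNorm_add_le hp (hg.sub hf) hf
  rw [sub_add_cancel] at h1 h2
  rw [pNorm_sub_comm g f] at h2
  rw [abs_le]
  constructor <;> linarith

lemma pNorm_const_smul [NormedSpace ℝ F] (hp : 1 < p) (c : ℝ) (f : α → F) :
    pNorm p μ (c • f) = |c| * pNorm p μ f := by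
  have : ∀ x, ‖(c • f) x‖ ^ p = |c| ^ p * ‖f x‖ ^ p := fun x => by
    rw [Pi.smul_apply, norm_smul, Real.norm_eq_abs, Real.mul_rpow (abs_nonneg _) (norm_nonneg _)]
  simp only [pNorm, this]
  rw [integral_const_mul, Real.mul_rpow (by positivity) (integral_norm_rpow_nonneg f),
    ← Real.rpow_mul (abs_nonneg c), mul_one_div_cancel (by linarith), Real.rpow_one]

lemma tendsto_pNorm (hp : 1 < p) {ι : Type*} {l : Filter ι} {f : ι → α → F} {g : α → F}
    (hf : ∀ n, MemLp (f n) (ENNReal.ofReal p) μ) (hg : MemLp g (ENNReal.ofReal p) μ)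
    (h : Tendsto (fun n => pNorm p μ (f n - g)) l (𝓝 0)) :
    Tendsto (fun n => pNorm p μ (f n)) l (𝓝 (pNorm p μ g)) := by
  rw [tendsto_iff_dist_tendsto_zero]
  exact squeeze_zero (fun _ => dist_nonneg) (fun n => abs_pNorm_sub_le hp (hf n) hg) h

lemma memLp_norm_rpow_sub_one (hp : 1 < p) {f : α → F} (hf : MemLp f (ENNReal.ofReal p) μ) :
    MemLp (fun x => ‖f x‖ ^ (p - 1)) (ENNReal.ofReal (p / (p - 1))) μ := by
  have := hf.norm_rpow_div (ENNReal.ofReal (p - 1))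
  rwa [ENNReal.toReal_ofReal (by linarith), ← ENNReal.ofReal_div_of_pos (by linarith)] at this

lemma holderConjugate_div (hp : 1 < p) : (p / (p - 1)).HolderConjugate p :=
  (Real.HolderConjugate.conjExponent hp).symm

lemma integrable_norm_rpow_mul_norm (hp : 1 < p) {F' : Type*} [NormedAddCommGroup F'] {f : α → F}
    {g : α → F'} (hf : MemLp f (ENNReal.ofReal p) μ) (hg : MemLp g (ENNReal.ofReal p) μ) :
    Integrable (fun x => ‖f x‖ ^ (p - 1) * ‖g x‖) μ := by
  have hpq := holderConjugate_div hp
  have : ENNReal.HolderConjugate (ENNReal.ofReal (p / (p - 1))) (ENNReal.ofReal p) := by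
    exact hpq.ennrealOfReal
  exact (memLp_norm_rpow_sub_one hp hf).integrable_mul hg.norm

/-- Hölder with exponents `p / (p - 1)` and `p`: the first norm of `‖f‖ ^ (p - 1)` is the `(p -
1)`-th power of the `L^p` norm of `f`. -/
lemma integral_norm_rpow_mul_norm_le (hp : 1 < p) {F' : Type*} [NormedAddCommGroup F'] {f : α → F}
    {g : α → F'} (hf : MemLp f (ENNReal.ofReal p) μ) (hg : MemLp g (ENNReal.ofReal p) μ) :
    ∫ x, ‖f x‖ ^ (p - 1) * ‖g x‖ ∂μ ≤ pNorm p μ f ^ (p - 1) * pNorm p μ g := by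
  have h := integral_mul_le_Lp_mul_Lq_of_nonneg (holderConjugate_div hp)
    (Eventually.of_forall fun x => Real.rpow_nonneg (norm_nonneg (f x)) (p - 1))
    (Eventually.of_forall fun x => norm_nonneg (g x)) (memLp_norm_rpow_sub_one hp hf) hg.norm
  refine h.trans (le_of_eq ?_)
  have hp1 : p - 1 ≠ 0 := by linarith
  have e : ∀ x, (‖f x‖ ^ (p - 1)) ^ (p / (p - 1)) = ‖f x‖ ^ p := fun x => by
    rw [← Real.rpow_mul (norm_nonneg _), mul_div_cancel₀ _ hp1]
  simp only [e, pNorm]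
  rw [← Real.rpow_mul (integral_norm_rpow_nonneg f)]
  congr 2
  field_simp

lemma integral_norm_le_pNorm [IsFiniteMeasure μ] (hp : 1 < p) {g : α → F}
    (hg : MemLp g (ENNReal.ofReal p) μ) :
    ∫ x, ‖g x‖ ∂μ ≤ μ.real Set.univ ^ (1 - 1 / p) * pNorm p μ g := by
  have h := integral_norm_rpow_mul_norm_le (μ := μ) (f := fun _ : α => (1 : ℝ)) hp
    (memLp_const 1) hg
  simp only [norm_one, Real.one_rpow, one_mul] at h
  refine h.trans (le_of_eq ?_)
  congr 1
  simp only [pNorm, norm_one, Real.one_rpow, integral_const, smul_eq_mul, mul_one]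
  rw [← Real.rpow_mul measureReal_nonneg]
  congr 1
  have : p ≠ 0 := by linarith
  field_simp

lemma exists_tendsto_of_cauchy_pNorm [CompleteSpace F] (hp : 1 < p) {f : ℕ → α → F}
    (hf : ∀ n, MemLp (f n) (ENNReal.ofReal p) μ)
    (h : Tendsto (fun n : ℕ × ℕ => pNorm p μ (f n.1 - f n.2)) atTop (𝓝 0)) :
    ∃ g, MemLp g (ENNReal.ofReal p) μ ∧ Tendsto (fun n => pNorm p μ (f n - g)) atTop (𝓝 0) := by
  have : Fact (1 ≤ ENNReal.ofReal p) := ⟨one_le_ofReal_of_one_lt hp⟩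
  have hc : CauchySeq fun n => (hf n).toLp (f n) := by
    rw [cauchySeq_iff_tendsto_dist_atTop_0]
    refine h.congr fun n => ?_
    rw [dist_eq_norm, ← MemLp.toLp_sub, Lp.norm_toLp, pNorm_eq_toReal hp ((hf n.1).sub (hf n.2))]
  obtain ⟨g, hg⟩ := cauchySeq_tendsto_of_complete hc
  refine ⟨g, Lp.memLp g, ?_⟩
  have h2 : Tendsto (fun n => (hf n).toLp (f n)) atTop (𝓝 ((Lp.memLp g).toLp g)) := by
    rwa [Lp.toLp_coeFn]
  rw [tendsto_iff_dist_tendsto_zero] at h2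
  refine h2.congr fun n => ?_
  rw [dist_eq_norm, ← MemLp.toLp_sub, Lp.norm_toLp,
    pNorm_eq_toReal hp ((hf n).sub (Lp.memLp g))]

section Inner

variable {G : Type*} [NormedAddCommGroup G] [InnerProductSpace ℝ G]

lemma norm_rpow_mul_inner_le (a b : G) :
    ‖‖a‖ ^ (p - 2) * inner ℝ a b‖ ≤ ‖a‖ ^ (p - 1) * ‖b‖ := by
  rw [norm_mul, Real.norm_of_nonneg (Real.rpow_nonneg (norm_nonneg a) _)]
  rcases eq_or_ne a 0 with rfl | ha
  · simp only [inner_zero_left, norm_zero, mul_zero]; positivity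
  · calc ‖a‖ ^ (p - 2) * ‖(inner ℝ a b : ℝ)‖ ≤ ‖a‖ ^ (p - 2) * (‖a‖ * ‖b‖) := by
          gcongr; exact norm_inner_le_norm a b
      _ = ‖a‖ ^ (p - 1) * ‖b‖ := by
          rw [← mul_assoc, ← Real.rpow_add_one (norm_ne_zero_iff.2 ha)]; ring_nf

lemma norm_rpow_mul_inner_self (hp : 1 < p) (a : G) :
    ‖a‖ ^ (p - 2) * inner ℝ a a = ‖a‖ ^ p := by
  rcases eq_or_ne a 0 with rfl | ha
  · rw [inner_zero_left, mul_zero, norm_zero, Real.zero_rpow (by linarith)]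
  · rw [real_inner_self_eq_norm_sq, ← Real.rpow_natCast, ← Real.rpow_add (norm_pos_iff.2 ha)]
    norm_num

lemma integrable_norm_rpow_mul_inner (hp : 1 < p) {f g : α → G}
    (hf : MemLp f (ENNReal.ofReal p) μ) (hg : MemLp g (ENNReal.ofReal p) μ) :
    Integrable (fun x => ‖f x‖ ^ (p - 2) * inner ℝ (f x) (g x)) μ := by
  refine (integrable_norm_rpow_mul_norm hp hf hg).mono' ?_
    (Eventually.of_forall fun x => norm_rpow_mul_inner_le _ _)
  exact (hf.1.norm.aemeasurable.pow_const _).aestronglyMeasurable.mul (hf.1.inner hg.1)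

lemma abs_integral_norm_rpow_mul_inner_le (hp : 1 < p) {f g : α → G}
    (hf : MemLp f (ENNReal.ofReal p) μ) (hg : MemLp g (ENNReal.ofReal p) μ) :
    |∫ x, ‖f x‖ ^ (p - 2) * inner ℝ (f x) (g x) ∂μ| ≤ pNorm p μ f ^ (p - 1) * pNorm p μ g := by
  refine le_trans ?_ (integral_norm_rpow_mul_norm_le hp hf hg)
  exact norm_integral_le_of_norm_le (integrable_norm_rpow_mul_norm hp hf hg)
    (Eventually.of_forall fun x => norm_rpow_mul_inner_le _ _)

/-- Minimizing sequences for the `L^p` norm in a set closed under midpoints are Cauchy. -/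
lemma tendsto_pNorm_sub_of_minimizing [FiniteDimensional ℝ G] (hp : 1 < p) {f : ℕ → α → G} {K : ℝ}
    (hf : ∀ n, MemLp (f n) (ENNReal.ofReal p) μ)
    (hK : Tendsto (fun n => ∫ x, ‖f n x‖ ^ p ∂μ) atTop (𝓝 K))
    (hmid : ∀ n m, K ≤ ∫ x, ‖(2⁻¹ : ℝ) • (f n x + f m x)‖ ^ p ∂μ) :
    Tendsto (fun n : ℕ × ℕ => pNorm p μ (f n.1 - f n.2)) atTop (𝓝 0) := by
  have hp0 : 0 < p := by linarith
  have hlim1 : Tendsto (fun n : ℕ × ℕ => ∫ x, ‖f n.1 x‖ ^ p ∂μ) atTop (𝓝 K) := by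
    rw [← prod_atTop_atTop_eq]; exact hK.comp tendsto_fst
  have hlim2 : Tendsto (fun n : ℕ × ℕ => ∫ x, ‖f n.2 x‖ ^ p ∂μ) atTop (𝓝 K) := by
    rw [← prod_atTop_atTop_eq]; exact hK.comp tendsto_snd
  have hK0 : 0 ≤ K := ge_of_tendsto' hK fun n => integral_norm_rpow_nonneg _
  have key : Tendsto (fun n : ℕ × ℕ => ∫ x, ‖(f n.1 - f n.2) x‖ ^ p ∂μ) atTop (𝓝 0) := by
    rw [Metric.tendsto_nhds]
    intro η hη
    -- The `C` term tends to `C (K + K - 2K) = 0`, so only `2Kε < η` is needed in the limit.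
    set ε := η / (2 * (2 * K + 1)) with hε
    have hε0 : 0 < ε := by positivity
    obtain ⟨C, hC0, hC⟩ := exists_norm_sub_rpow_le (E := G) hp hε0
    have hbound : ∀ n : ℕ × ℕ, ∫ x, ‖(f n.1 - f n.2) x‖ ^ p ∂μ ≤
        C * ((∫ x, ‖f n.1 x‖ ^ p ∂μ) + (∫ x, ‖f n.2 x‖ ^ p ∂μ) - 2 * K) +
          ε * ((∫ x, ‖f n.1 x‖ ^ p ∂μ) + ∫ x, ‖f n.2 x‖ ^ p ∂μ) := by
      intro n
      have i1 := integrable_norm_rpow hp (hf n.1)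
      have i2 := integrable_norm_rpow hp (hf n.2)
      have i3 : Integrable (fun x => ‖(2⁻¹ : ℝ) • (f n.1 x + f n.2 x)‖ ^ p) μ :=
        integrable_norm_rpow hp (((hf n.1).add (hf n.2)).const_smul (2⁻¹ : ℝ))
      have i4 := integrable_norm_rpow hp ((hf n.1).sub (hf n.2))
      have i5 : Integrable (fun x => ‖f n.1 x‖ ^ p + ‖f n.2 x‖ ^ p) μ := i1.add i2
      have i6 : Integrable (fun x => ‖f n.1 x‖ ^ p + ‖f n.2 x‖ ^ p -
          2 * ‖(2⁻¹ : ℝ) • (f n.1 x + f n.2 x)‖ ^ p) μ := i5.sub (i3.const_mul 2)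
      have h1 := integral_mono i4 ((i6.const_mul C).add (i5.const_mul ε))
        fun x => hC (f n.1 x) (f n.2 x)
      simp only [Pi.add_apply] at h1
      rw [integral_add (i6.const_mul C) (i5.const_mul ε), integral_const_mul, integral_const_mul,
        integral_sub i5 (i3.const_mul 2), integral_add i1 i2, integral_const_mul] at h1
      have h2 := mul_le_mul_of_nonneg_left (hmid n.1 n.2) hC0
      linarith
    have hlim := ((hlim1.add hlim2).sub_const (2 * K)).const_mul C |>.add
      ((hlim1.add hlim2).const_mul ε)
    have hlt : C * (K + K - 2 * K) + ε * (K + K) < η := by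
      have e1 : ε * (2 * (2 * K + 1)) = η := div_mul_cancel₀ _ (by positivity)
      nlinarith
    filter_upwards [hlim.eventually (gt_mem_nhds hlt)] with n hn
    rw [Real.dist_eq, sub_zero, abs_of_nonneg (integral_norm_rpow_nonneg _)]
    exact (hbound n).trans_lt hn
  have := key.rpow_const (p := 1 / p) (Or.inr (by positivity))
  rwa [Real.zero_rpow (by positivity)] at this

/-- The derivative of `t ↦ ∫ ‖f + t g‖ ^ p` at `0`. -/
lemma hasDerivAt_integral_norm_add_smul_rpow (hp : 1 < p) {f g : α → G}
    (hf : MemLp f (ENNReal.ofReal p) μ) (hg : MemLp g (ENNReal.ofReal p) μ) :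
    HasDerivAt (fun t : ℝ => ∫ x, ‖f x + t • g x‖ ^ p ∂μ)
      (p * ∫ x, ‖f x‖ ^ (p - 2) * inner ℝ (f x) (g x) ∂μ) 0 := by
  have hm : ∀ t : ℝ, MemLp (fun x => f x + t • g x) (ENNReal.ofReal p) μ := fun t =>
    hf.add (hg.const_smul t)
  have hd : ∀ x, ∀ t : ℝ, HasDerivAt (fun t : ℝ => ‖f x + t • g x‖ ^ p)
      (p * (‖f x + t • g x‖ ^ (p - 2) * inner ℝ (f x + t • g x) (g x))) t := by
    intro x t
    have h1 : HasDerivAt (fun t : ℝ => f x + t • g x) (g x) t := by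
      simpa using ((hasDerivAt_id t).smul_const (g x)).const_add (f x)
    have h2 := (hasFDerivAt_norm_rpow (f x + t • g x) hp).comp_hasDerivAt t h1
    refine h2.congr_deriv ?_
    simp only [smul_apply, innerSL_apply_apply, smul_eq_mul, mul_assoc]
  have hb : MemLp (fun x => ‖f x‖ + ‖g x‖) (ENNReal.ofReal p) μ := hf.norm.add hg.norm
  have := hasDerivAt_integral_of_dominated_loc_of_deriv_le (μ := μ) (s := Metric.ball (0 : ℝ) 1)
    (x₀ := (0 : ℝ)) (F := fun t x => ‖f x + t • g x‖ ^ p)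
    (F' := fun t x => p * (‖f x + t • g x‖ ^ (p - 2) * inner ℝ (f x + t • g x) (g x)))
    -- Since `|t| < 1`, `‖f + t g‖ ≤ ‖f‖ + ‖g‖`; integrability of the bound is Hölder again.
    (bound := fun x => p * (‖‖f x‖ + ‖g x‖‖ ^ (p - 1) * ‖g x‖))
    (Metric.ball_mem_nhds _ one_pos)
    (Eventually.of_forall fun t => (integrable_norm_rpow hp (hm t)).1)
    (integrable_norm_rpow hp (hm 0))
    ((integrable_norm_rpow_mul_inner hp (hm 0) hg).const_mul p).1
    (Eventually.of_forall fun x t ht => ?_)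
    ((integrable_norm_rpow_mul_norm hp hb hg).const_mul p)
    (Eventually.of_forall fun x t _ => hd x t)
  · have h := this.2
    simp only [zero_smul, add_zero, integral_const_mul] at h
    exact h
  · rw [norm_mul, Real.norm_of_nonneg (by linarith : 0 ≤ p)]
    refine mul_le_mul_of_nonneg_left ?_ (by linarith)
    refine (norm_rpow_mul_inner_le _ _).trans ?_
    refine mul_le_mul_of_nonneg_right ?_ (norm_nonneg _)
    refine Real.rpow_le_rpow (norm_nonneg _) ?_ (by linarith)
    rw [Real.norm_of_nonneg (by positivity)]
    refine (norm_add_le _ _).trans (add_le_add_right ?_ _)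
    rw [norm_smul]
    refine mul_le_of_le_one_left (norm_nonneg _) ?_
    rw [mem_ball_zero_iff] at ht
    exact ht.le

end Inner

end PNorm

/-! ### Test functions and their `L^p` limits -/

section TestFunctions

variable {D : ℕ} {Ω : Set (EuclideanSpace ℝ (Fin D))}

lemma norm_gradient {E : Type*} [NormedAddCommGroup E] [InnerProductSpace ℝ E] [CompleteSpace E]
    (φ : E → ℝ) (x : E) : ‖∇ φ x‖ = ‖fderiv ℝ φ x‖ := by
  rw [← toDual_gradient, LinearIsometryEquiv.norm_map]

namespace IsTestFunction

variable {φ ψ : EuclideanSpace ℝ (Fin D) → ℝ}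

lemma differentiable (h : IsTestFunction Ω φ) : Differentiable ℝ φ :=
  h.contDiff.differentiable (by simp)

lemma continuous_fderiv (h : IsTestFunction Ω φ) : Continuous (fderiv ℝ φ) :=
  h.contDiff.continuous_fderiv (by simp)

lemma continuous_gradient (h : IsTestFunction Ω φ) : Continuous (∇ φ) :=
  ((InnerProductSpace.toDual ℝ _).symm.continuous).comp h.continuous_fderiv

lemma hasCompactSupport_gradient (h : IsTestFunction Ω φ) : HasCompactSupport (∇ φ) :=
  (h.hasCompactSupport.fderiv ℝ).comp_left (g := (InnerProductSpace.toDual ℝ _).symm) (map_zero _)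

lemma eq_zero_of_notMem (h : IsTestFunction Ω φ) {x : EuclideanSpace ℝ (Fin D)} (hx : x ∉ Ω) :
    φ x = 0 :=
  image_eq_zero_of_notMem_tsupport fun hx' => hx (h.tsupport_subset hx')

lemma gradient_eq_zero_of_notMem (h : IsTestFunction Ω φ) {x : EuclideanSpace ℝ (Fin D)}
    (hx : x ∉ Ω) : ∇ φ x = 0 := by
  rw [← norm_eq_zero, norm_gradient, norm_eq_zero]
  exact image_eq_zero_of_notMem_tsupport
    fun hx' => hx (h.tsupport_subset (tsupport_fderiv_subset ℝ hx'))

lemma add (h : IsTestFunction Ω φ) (h' : IsTestFunction Ω ψ) : IsTestFunction Ω (φ + ψ) :=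
  ⟨h.contDiff.add h'.contDiff, h.hasCompactSupport.add h'.hasCompactSupport,
    (tsupport_add φ ψ).trans (Set.union_subset h.tsupport_subset h'.tsupport_subset)⟩

lemma const_smul (h : IsTestFunction Ω φ) (c : ℝ) : IsTestFunction Ω (c • φ) :=
  ⟨contDiff_const.smul h.contDiff, h.hasCompactSupport.smul_left (f := fun _ => c),
    (closure_mono (Function.support_const_smul_subset c φ)).trans h.tsupport_subset⟩

lemma sub (h : IsTestFunction Ω φ) (h' : IsTestFunction Ω ψ) : IsTestFunction Ω (φ - ψ) := by
  have := h.add (h'.const_smul (-1))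
  rwa [neg_one_smul, ← sub_eq_add_neg] at this

lemma gradient_add (h : IsTestFunction Ω φ) (h' : IsTestFunction Ω ψ) :
    ∇ (φ + ψ) = ∇ φ + ∇ ψ := by
  funext x
  simp only [gradient, Pi.add_apply]
  rw [fderiv_add (h.differentiable x) (h'.differentiable x), map_add]

lemma gradient_const_smul (h : IsTestFunction Ω φ) (c : ℝ) : ∇ (c • φ) = c • ∇ φ := by
  funext x
  simp only [gradient, Pi.smul_apply]
  rw [fderiv_const_smul (h.differentiable x), map_smul]

lemma gradient_sub (h : IsTestFunction Ω φ) (h' : IsTestFunction Ω ψ) :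
    ∇ (φ - ψ) = ∇ φ - ∇ ψ := by
  funext x
  simp only [gradient, Pi.sub_apply]
  rw [fderiv_sub (h.differentiable x) (h'.differentiable x), map_sub]

lemma memLp (h : IsTestFunction Ω φ) (q : ENNReal) : MemLp φ q (volume.restrict Ω) :=
  (h.contDiff.continuous.memLp_of_hasCompactSupport h.hasCompactSupport).restrict Ω

lemma memLp_gradient (h : IsTestFunction Ω φ) (q : ENNReal) :
    MemLp (∇ φ) q (volume.restrict Ω) :=
  (h.continuous_gradient.memLp_of_hasCompactSupport h.hasCompactSupport_gradient).restrict Ω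

lemma integrable (h : IsTestFunction Ω φ) : Integrable φ :=
  h.contDiff.continuous.integrable_of_hasCompactSupport h.hasCompactSupport

lemma setIntegral_eq (h : IsTestFunction Ω φ) : ∫ x in Ω, φ x = ∫ x, φ x :=
  setIntegral_eq_integral_of_forall_compl_eq_zero fun _ hx => h.eq_zero_of_notMem hx

lemma hasWeakGradient (h : IsTestFunction Ω φ) : HasWeakGradient Ω φ (∇ φ) := by
  intro ψ hψ
  have hc1 := h.contDiff.continuous
  have hc2 := hψ.contDiff.continuous
  have hg1 := h.continuous_gradient
  have hg2 := hψ.continuous_gradient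
  have i1 : Integrable fun x => φ x • ∇ ψ x :=
    (hc1.smul hg2).integrable_of_hasCompactSupport h.hasCompactSupport.smul_right
  have i2 : Integrable fun x => ψ x • ∇ φ x :=
    (hc2.smul hg1).integrable_of_hasCompactSupport hψ.hasCompactSupport.smul_right
  have i3 : Integrable fun x => φ x * ψ x :=
    (hc1.mul hc2).integrable_of_hasCompactSupport h.hasCompactSupport.mul_right
  rw [setIntegral_eq_integral_of_forall_compl_eq_zero fun x hx => by
      rw [h.eq_zero_of_notMem hx, zero_smul],
    setIntegral_eq_integral_of_forall_compl_eq_zero fun x hx => by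
      rw [hψ.eq_zero_of_notMem hx, zero_smul]]
  refine ext_inner_left ℝ fun w => ?_
  rw [inner_neg_right, ← integral_inner i1, ← integral_inner i2]
  have e : ∀ (f g : EuclideanSpace ℝ (Fin D) → ℝ) (x : EuclideanSpace ℝ (Fin D)),
      inner ℝ w (f x • ∇ g x) = f x * fderiv ℝ g x w := fun f g x => by
    rw [real_inner_smul_right, real_inner_comm, inner_gradient_left]
  have j1 := i1.const_inner w (𝕜 := ℝ)
  have j2 := i2.const_inner w (𝕜 := ℝ)
  simp only [e] at j1 j2 ⊢
  rw [integral_mul_fderiv_eq_neg_fderiv_mul_of_integrable (by simpa only [mul_comm] using j2) j1 i3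
    (fun x _ => h.differentiable x) fun x _ => hψ.differentiable x]
  simp only [mul_comm]

end IsTestFunction

/-- `L^p` limits of test functions and of their gradients are Sobolev functions vanishing on the
boundary. -/
lemma MemSobolevZero.of_tendsto {p : ℝ} (hp : 1 < p) (hΩ : IsConvexDomain Ω)
    {u : EuclideanSpace ℝ (Fin D) → ℝ} {G : EuclideanSpace ℝ (Fin D) → EuclideanSpace ℝ (Fin D)}
    (hu : MemLp u (ENNReal.ofReal p) (volume.restrict Ω))
    (hG : MemLp G (ENNReal.ofReal p) (volume.restrict Ω))
    {φ : ℕ → EuclideanSpace ℝ (Fin D) → ℝ} (hφ : ∀ n, IsTestFunction Ω (φ n))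
    (h1 : Tendsto (fun n => pNorm p (volume.restrict Ω) (φ n - u)) atTop (𝓝 0))
    (h2 : Tendsto (fun n => pNorm p (volume.restrict Ω) (∇ (φ n) - G)) atTop (𝓝 0)) :
    MemSobolevZero p Ω u G := by
  have : Fact (volume Ω < ⊤) := ⟨hΩ.volume_ne_top.lt_top⟩
  refine ⟨⟨hu, hG, fun ψ hψ => ?_⟩, φ, hφ, ?_, ?_⟩
  -- On a set of finite measure `L^p` convergence gives `L¹` convergence. As `ψ` and `∇ψ` are
  -- bounded, integration by parts for `φ n` passes to the limit.
  · have hbd : ∀ {F : Type} [NormedAddCommGroup F] {f : EuclideanSpace ℝ (Fin D) → F},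
        Continuous f → HasCompactSupport f → ∃ C, ∀ x, ‖f x‖ ≤ C := fun {F} _ {f} hf hf' =>
      hf.bounded_above_of_compact_support hf'
    obtain ⟨C1, hC1⟩ := hbd hψ.continuous_gradient hψ.hasCompactSupport_gradient
    obtain ⟨C2, hC2⟩ := hbd hψ.contDiff.continuous hψ.hasCompactSupport
    have hconv : ∀ {F : Type} [NormedAddCommGroup F] {f : ℕ → EuclideanSpace ℝ (Fin D) → F}
        {g : EuclideanSpace ℝ (Fin D) → F},
        (∀ n, MemLp (f n) (ENNReal.ofReal p) (volume.restrict Ω)) →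
        MemLp g (ENNReal.ofReal p) (volume.restrict Ω) →
        Tendsto (fun n => pNorm p (volume.restrict Ω) (f n - g)) atTop (𝓝 0) →
        Tendsto (fun n => ∫ x in Ω, ‖f n x - g x‖) atTop (𝓝 0) := by
      intro F _ f g hf hg h
      have h' := h.const_mul ((volume.restrict Ω).real Set.univ ^ (1 - 1 / p))
      rw [mul_zero] at h'
      exact squeeze_zero (fun n => integral_nonneg fun _ => norm_nonneg _)
        (fun n => integral_norm_le_pNorm hp ((hf n).sub hg)) h'
    have hint : ∀ {F : Type} [NormedAddCommGroup F] {g : EuclideanSpace ℝ (Fin D) → F},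
        MemLp g (ENNReal.ofReal p) (volume.restrict Ω) → Integrable g (volume.restrict Ω) :=
      fun {F} _ {g} hg => hg.integrable (one_le_ofReal_of_one_lt hp)
    have hφu := hconv (fun n => (hφ n).memLp _) hu h1
    have hφG := hconv (fun n => (hφ n).memLp_gradient _) hG h2
    have t1 : Tendsto (fun n => ∫ x in Ω, φ n x • ∇ ψ x) atTop (𝓝 (∫ x in Ω, u x • ∇ ψ x)) := by
      have hI : ∀ {f : EuclideanSpace ℝ (Fin D) → ℝ}, Integrable f (volume.restrict Ω) →
          Integrable (fun x => f x • ∇ ψ x) (volume.restrict Ω) := fun hf =>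
        hf.smul_bdd C1 hψ.continuous_gradient.aestronglyMeasurable (Eventually.of_forall hC1)
      rw [tendsto_iff_norm_sub_tendsto_zero]
      refine squeeze_zero (fun _ => norm_nonneg _) (fun n => ?_)
        (by simpa using hφu.const_mul C1)
      rw [← integral_sub (hI (hint ((hφ n).memLp _))) (hI (hint hu)), ← integral_const_mul]
      refine norm_integral_le_of_norm_le
        (((hint ((hφ n).memLp _)).sub (hint hu)).norm.const_mul C1) (Eventually.of_forall fun x => ?_)
      rw [← sub_smul, norm_smul, mul_comm]
      exact mul_le_mul_of_nonneg_right (hC1 x) (norm_nonneg _)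
    have t2 : Tendsto (fun n => ∫ x in Ω, ψ x • ∇ (φ n) x) atTop (𝓝 (∫ x in Ω, ψ x • G x)) := by
      have hI : ∀ {f : EuclideanSpace ℝ (Fin D) → EuclideanSpace ℝ (Fin D)},
          Integrable f (volume.restrict Ω) →
          Integrable (fun x => ψ x • f x) (volume.restrict Ω) := fun hf =>
        hf.bdd_smul C2 hψ.contDiff.continuous.aestronglyMeasurable (Eventually.of_forall hC2)
      rw [tendsto_iff_norm_sub_tendsto_zero]
      refine squeeze_zero (fun _ => norm_nonneg _) (fun n => ?_)
        (by simpa using hφG.const_mul C2)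
      rw [← integral_sub (hI (hint ((hφ n).memLp_gradient _))) (hI (hint hG)),
        ← integral_const_mul]
      refine norm_integral_le_of_norm_le
        (((hint ((hφ n).memLp_gradient _)).sub (hint hG)).norm.const_mul C2)
        (Eventually.of_forall fun x => ?_)
      rw [← smul_sub, norm_smul]
      exact mul_le_mul_of_nonneg_right (hC2 x) (norm_nonneg _)
    exact tendsto_nhds_unique t1 (t2.neg.congr fun n => ((hφ n).hasWeakGradient ψ hψ).symm)
  · have := ENNReal.tendsto_ofReal h1
    rw [ENNReal.ofReal_zero] at this
    exact this.congr fun n => (eLpNorm_eq_ofReal_pNorm hp (((hφ n).memLp _).sub hu)).symm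
  · have := ENNReal.tendsto_ofReal h2
    rw [ENNReal.ofReal_zero] at this
    exact this.congr fun n => (eLpNorm_eq_ofReal_pNorm hp (((hφ n).memLp_gradient _).sub hG)).symm

end TestFunctions

/-! ### Poincaré inequalities on convex domains and existence of the torsion function -/

section Existence

variable {D : ℕ} {Ω : Set (EuclideanSpace ℝ (Fin D))}

namespace IsConvexDomain

lemma integral_abs_le (hΩ : IsConvexDomain Ω) (hD : 1 ≤ D) {v : EuclideanSpace ℝ (Fin D) → ℝ}
    (hv : ContDiff ℝ 1 v) (hvc : HasCompactSupport v) (hvs : tsupport v ⊆ Ω) :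
    ∫ x, |v x| ≤ (D + 1) * avgDist Ω * ∫ x, ‖fderiv ℝ v x‖ :=
  integral_abs_le_inradius_mul hΩ.isOpen hΩ.isBounded hΩ.convex (hΩ.frontier_nonempty hD)
    (mul_nonneg (by positivity) (hΩ.avgDist_pos hD).le)
    (fun _ hx => hΩ.infDist_le_mul_avgDist hD hx) hv hvc hvs

/-- The `L^p` Poincaré inequality for test functions. -/
lemma pNorm_le (hΩ : IsConvexDomain Ω) (hD : 1 ≤ D) {p : ℝ} (hp : 1 < p)
    {φ : EuclideanSpace ℝ (Fin D) → ℝ} (hφ : IsTestFunction Ω φ) :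
    pNorm p (volume.restrict Ω) φ ≤
      (D + 1) * avgDist Ω * p * pNorm p (volume.restrict Ω) (∇ φ) := by
  set μ := volume.restrict Ω with hμ
  set R := (D + 1) * avgDist Ω with hR
  have hR0 : 0 ≤ R := mul_nonneg (by positivity) (hΩ.avgDist_pos hD).le
  have hp0 : 0 < p := by linarith
  have hφ1 : ContDiff ℝ 1 φ := hφ.contDiff.of_le (by exact_mod_cast le_top)
  have hc : HasCompactSupport fun x => ‖φ x‖ ^ p :=
    hφ.hasCompactSupport.comp_left (g := fun y : ℝ => ‖y‖ ^ p) (by simp [Real.zero_rpow hp0.ne'])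
  have hs : tsupport (fun x => ‖φ x‖ ^ p) ⊆ Ω := by
    refine (closure_mono fun x hx => ?_).trans hφ.tsupport_subset
    intro h0
    exact hx (by simp only; rw [h0, norm_zero, Real.zero_rpow hp0.ne'])
  -- The `L¹` inequality is applied to `|φ| ^ p`, whose gradient is at most `p |φ| ^ (p - 1) |∇φ|`;
  -- Hölder then allows a factor `‖φ‖_p ^ (p - 1)` to be cancelled.
  have h1 := hΩ.integral_abs_le hD (hφ1.norm_rpow hp) hc hs
  have i1 := integrable_norm_rpow_mul_norm (μ := μ) hp (hφ.memLp _) (hφ.memLp_gradient _)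
  have h2 : ∫ x, ‖fderiv ℝ (fun x => ‖φ x‖ ^ p) x‖ ≤
      p * (pNorm p μ φ ^ (p - 1) * pNorm p μ (∇ φ)) := by
    refine le_trans ?_ (mul_le_mul_of_nonneg_left (integral_norm_rpow_mul_norm_le hp
      (hφ.memLp _) (hφ.memLp_gradient _)) hp0.le)
    rw [← integral_const_mul, ← setIntegral_eq_integral_of_forall_compl_eq_zero (s := Ω)]
    · refine integral_mono_of_nonneg (Eventually.of_forall fun _ => norm_nonneg _)
        (i1.const_mul p) (Eventually.of_forall fun x => ?_)
      simp only
      rw [norm_gradient, ← mul_assoc]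
      exact norm_fderiv_norm_rpow_le hφ.differentiable hp
    · intro x hx
      rw [norm_eq_zero]
      exact image_eq_zero_of_notMem_tsupport fun h => hx (hs (tsupport_fderiv_subset ℝ h))
  have h3 : ∫ x, |‖φ x‖ ^ p| = pNorm p μ φ ^ p := by
    rw [pNorm_rpow hp, hμ, setIntegral_eq_integral_of_forall_compl_eq_zero]
    · simp only [abs_of_nonneg (Real.rpow_nonneg (norm_nonneg _) p)]
    · intro x hx
      rw [hφ.eq_zero_of_notMem hx, norm_zero, Real.zero_rpow hp0.ne']
  rw [h3] at h1
  have h4 := h1.trans (mul_le_mul_of_nonneg_left h2 hR0)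
  rcases (pNorm_nonneg (p := p) (μ := μ) φ).eq_or_lt with h0 | h0
  · rw [← h0]
    exact mul_nonneg (mul_nonneg hR0 hp0.le) (pNorm_nonneg _)
  · have h5 : pNorm p μ φ ^ p = pNorm p μ φ ^ (p - 1) * pNorm p μ φ := by
      rw [← Real.rpow_add_one h0.ne']; ring_nf
    rw [h5] at h4
    refine le_of_mul_le_mul_left ?_ (Real.rpow_pos_of_pos h0 (p - 1))
    linarith

/-- The `L¹` Poincaré inequality followed by Hölder on the gradient. The constant has no extra
factor `p`, unlike the `L^p` version, so the resulting bound on `S` is uniform in `p`. -/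
lemma abs_setIntegral_le (hΩ : IsConvexDomain Ω) (hD : 1 ≤ D) {p : ℝ} (hp : 1 < p)
    {φ : EuclideanSpace ℝ (Fin D) → ℝ} (hφ : IsTestFunction Ω φ) :
    |∫ x in Ω, φ x| ≤ (D + 1) * avgDist Ω * volume.real Ω ^ (1 - 1 / p) *
      pNorm p (volume.restrict Ω) (∇ φ) := by
  have : Fact (volume Ω < ⊤) := ⟨hΩ.volume_ne_top.lt_top⟩
  have hφ1 : ContDiff ℝ 1 φ := hφ.contDiff.of_le (by exact_mod_cast le_top)
  have h1 := hΩ.integral_abs_le hD hφ1 hφ.hasCompactSupport hφ.tsupport_subset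
  have h2 := integral_norm_le_pNorm hp (hφ.memLp_gradient (Ω := Ω) (ENNReal.ofReal p))
  rw [measureReal_restrict_apply_univ] at h2
  have h3 : ∫ x in Ω, ‖∇ φ x‖ = ∫ x, ‖fderiv ℝ φ x‖ := by
    rw [setIntegral_eq_integral_of_forall_compl_eq_zero fun x hx => by
      rw [hφ.gradient_eq_zero_of_notMem hx, norm_zero]]
    simp only [norm_gradient]
  rw [h3] at h2
  have hR0 : 0 ≤ (D + 1) * avgDist Ω := mul_nonneg (by positivity) (hΩ.avgDist_pos hD).le
  have h4 : |∫ x in Ω, φ x| ≤ ∫ x, |φ x| := by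
    rw [hφ.setIntegral_eq]; exact abs_integral_le_integral_abs
  calc _ ≤ _ := h4
    _ ≤ _ := h1
    _ ≤ _ := mul_le_mul_of_nonneg_left h2 hR0
    _ = _ := by ring

lemma exists_isTestFunction (hΩ : IsConvexDomain Ω) :
    ∃ φ, IsTestFunction Ω φ ∧ ∫ x in Ω, φ x = 1 := by
  obtain ⟨c, hc⟩ := hΩ.nonempty
  obtain ⟨r, hr, hrΩ⟩ := Metric.isOpen_iff.1 hΩ.isOpen c hc
  let f : ContDiffBump c := ⟨r / 4, r / 2, by positivity, by linarith⟩
  have hf : IsTestFunction Ω f := by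
    refine ⟨f.contDiff, f.hasCompactSupport, ?_⟩
    rw [f.tsupport_eq]
    exact (Metric.closedBall_subset_ball (by simp only [f]; linarith)).trans hrΩ
  have hpos : 0 < ∫ x in Ω, f x := by
    rw [hf.setIntegral_eq]; exact f.integral_pos
  refine ⟨_, hf.const_smul (∫ x in Ω, f x)⁻¹, ?_⟩
  simp only [Pi.smul_apply, smul_eq_mul]
  rw [integral_const_mul, inv_mul_cancel₀ hpos.ne']

/-- Existence of the minimizer of the `p`-Dirichlet energy among functions of integral one, as the
limit of a sequence of test functions. -/
lemma exists_minimizer (hΩ : IsConvexDomain Ω) (hD : 1 ≤ D) {p : ℝ} (hp : 1 < p) :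
    ∃ (K : ℝ) (φ : ℕ → EuclideanSpace ℝ (Fin D) → ℝ) (u : EuclideanSpace ℝ (Fin D) → ℝ)
      (G : EuclideanSpace ℝ (Fin D) → EuclideanSpace ℝ (Fin D)), 0 < K ∧
      (∀ ψ, IsTestFunction Ω ψ → ∫ x in Ω, ψ x = 1 → K ≤ ∫ x in Ω, ‖∇ ψ x‖ ^ p) ∧
      (∀ n, IsTestFunction Ω (φ n)) ∧ (∀ n, ∫ x in Ω, φ n x = 1) ∧
      Tendsto (fun n => ∫ x in Ω, ‖∇ (φ n) x‖ ^ p) atTop (𝓝 K) ∧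
      MemLp u (ENNReal.ofReal p) (volume.restrict Ω) ∧
      MemLp G (ENNReal.ofReal p) (volume.restrict Ω) ∧
      Tendsto (fun n => pNorm p (volume.restrict Ω) (φ n - u)) atTop (𝓝 0) ∧
      Tendsto (fun n => pNorm p (volume.restrict Ω) (∇ (φ n) - G)) atTop (𝓝 0) := by
  have hp0 : 0 < p := by linarith
  set S : Set ℝ := {e | ∃ ψ, IsTestFunction Ω ψ ∧ ∫ x in Ω, ψ x = 1 ∧
    e = ∫ x in Ω, ‖∇ ψ x‖ ^ p} with hS
  have hSne : S.Nonempty := by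
    obtain ⟨ψ, h1, h2⟩ := hΩ.exists_isTestFunction
    exact ⟨_, ψ, h1, h2, rfl⟩
  set A := (D + 1) * avgDist Ω * volume.real Ω ^ (1 - 1 / p) with hA
  have hA0 : 0 < A := mul_pos (mul_pos (by positivity) (hΩ.avgDist_pos hD))
    (Real.rpow_pos_of_pos hΩ.volume_real_pos _)
  have hlow : ∀ e ∈ S, (A⁻¹) ^ p ≤ e := by
    rintro _ ⟨ψ, h1, h2, rfl⟩
    have h3 := hΩ.abs_setIntegral_le hD hp h1
    rw [h2, abs_one] at h3
    rw [← pNorm_rpow hp]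
    refine Real.rpow_le_rpow (by positivity) ?_ hp0.le
    rw [inv_le_iff_one_le_mul₀' hA0]
    exact h3
  have hbdd : BddBelow S := ⟨_, hlow⟩
  set K := sInf S with hK
  have hK0 : 0 < K := (by positivity : 0 < (A⁻¹) ^ p).trans_le (le_csInf hSne hlow)
  have hKle : ∀ ψ, IsTestFunction Ω ψ → ∫ x in Ω, ψ x = 1 → K ≤ ∫ x in Ω, ‖∇ ψ x‖ ^ p :=
    fun ψ h1 h2 => csInf_le hbdd ⟨ψ, h1, h2, rfl⟩
  obtain ⟨e, -, he, heS⟩ := exists_seq_tendsto_sInf hSne hbdd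
  choose φ hφ hφ1 hφe using heS
  have hφK : Tendsto (fun n => ∫ x in Ω, ‖∇ (φ n) x‖ ^ p) atTop (𝓝 K) :=
    he.congr hφe
  -- Midpoints of competitors are competitors, so their energy is at least `K` and uniform convexity
  -- makes the gradients Cauchy. The Poincaré inequality transfers this to the functions.
  have hcG := tendsto_pNorm_sub_of_minimizing hp (fun n => (hφ n).memLp_gradient _) hφK
    (fun n m => by
      have h1 := ((hφ n).add (hφ m)).const_smul (2⁻¹ : ℝ)
      have h2 := hKle _ h1 (by
        simp only [Pi.smul_apply, Pi.add_apply, smul_eq_mul]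
        rw [integral_const_mul, integral_add (hφ n).integrable.integrableOn
          (hφ m).integrable.integrableOn, hφ1, hφ1]
        norm_num)
      rw [((hφ n).add (hφ m)).gradient_const_smul, (hφ n).gradient_add (hφ m)] at h2
      exact h2)
  have hcu : Tendsto (fun n : ℕ × ℕ => pNorm p (volume.restrict Ω) (φ n.1 - φ n.2)) atTop (𝓝 0) := by
    refine squeeze_zero (fun _ => pNorm_nonneg _) (fun n => ?_)
      (by simpa using hcG.const_mul ((D + 1) * avgDist Ω * p))
    have := hΩ.pNorm_le hD hp ((hφ n.1).sub (hφ n.2))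
    rwa [(hφ n.1).gradient_sub (hφ n.2)] at this
  obtain ⟨u, hu, hul⟩ := exists_tendsto_of_cauchy_pNorm hp (fun n => (hφ n).memLp _) hcu
  obtain ⟨G, hG, hGl⟩ := exists_tendsto_of_cauchy_pNorm hp (fun n => (hφ n).memLp_gradient _) hcG
  exact ⟨K, φ, u, G, hK0, hKle, hφ, hφ1, hφK, hu, hG, hul, hGl⟩

/-- Existence of the `p`-torsion function. -/
theorem exists_isTorsionFunction (hΩ : IsConvexDomain Ω) (hD : 1 ≤ D) {p : ℝ} (hp : 1 < p) :
    ∃ u, IsTorsionFunction p Ω u := by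
  obtain ⟨K, φ, u, G, hK0, hKle, hφ, hφ1, hφK, hu, hG, hul, hGl⟩ := hΩ.exists_minimizer hD hp
  have hp0 : 0 < p := by linarith
  set μ := volume.restrict Ω with hμ
  have hscale : ∀ ψ, IsTestFunction Ω ψ → 0 < ∫ x in Ω, ψ x →
      K * (∫ x in Ω, ψ x) ^ p ≤ ∫ x in Ω, ‖∇ ψ x‖ ^ p := by
    intro ψ hψ hpos
    set c := ∫ x in Ω, ψ x with hc
    have h1 := hKle _ (hψ.const_smul c⁻¹) (by
      simp only [Pi.smul_apply, smul_eq_mul]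
      rw [integral_const_mul, ← hc, inv_mul_cancel₀ hpos.ne'])
    rw [hψ.gradient_const_smul, ← pNorm_rpow hp, pNorm_const_smul hp, abs_of_pos (inv_pos.2 hpos),
      Real.mul_rpow (inv_nonneg.2 hpos.le) (pNorm_nonneg _), pNorm_rpow hp,
      Real.inv_rpow hpos.le] at h1
    rwa [le_inv_mul_iff₀ (Real.rpow_pos_of_pos hpos p), mul_comm] at h1
  have hlim : ∀ ψ, IsTestFunction Ω ψ → ∀ t : ℝ, Tendsto
      (fun n => ∫ x in Ω, ‖∇ (φ n + t • ψ) x‖ ^ p) atTop (𝓝 (∫ x in Ω, ‖G x + t • ∇ ψ x‖ ^ p)) := by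
    intro ψ hψ t
    have hm : MemLp (G + t • ∇ ψ) (ENNReal.ofReal p) μ :=
      hG.add ((hψ.memLp_gradient _).const_smul t)
    have h1 := tendsto_pNorm hp (fun n => ((hφ n).add (hψ.const_smul t)).memLp_gradient _) hm (by
      refine hGl.congr fun n => ?_
      rw [(hφ n).gradient_add (hψ.const_smul t), hψ.gradient_const_smul, add_sub_add_right_eq_sub])
    have h2 := h1.rpow_const (p := p) (Or.inr hp0.le)
    simp only [pNorm_rpow hp] at h2
    exact h2
  have hGK : ∫ x in Ω, ‖G x‖ ^ p = K := by
    have h1 := hlim _ (hφ 0) 0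
    simp only [zero_smul, add_zero] at h1
    exact tendsto_nhds_unique h1 hφK
  have hEL : ∀ ψ, IsTestFunction Ω ψ →
      ∫ x in Ω, ‖G x‖ ^ (p - 2) * inner ℝ (G x) (∇ ψ x) = K * ∫ x in Ω, ψ x := by
    intro ψ hψ
    set c := ∫ x in Ω, ψ x with hc
    have hd1 := hasDerivAt_integral_norm_add_smul_rpow hp hG (hψ.memLp_gradient (Ω := Ω) _)
    have hd2 : HasDerivAt (fun t : ℝ => K * (1 + t * c) ^ p) (K * (p * c)) 0 := by
      have h1 : HasDerivAt (fun t : ℝ => 1 + t * c) c 0 := by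
        simpa using ((hasDerivAt_id (0 : ℝ)).mul_const c).const_add 1
      have h2 := (h1.rpow_const (p := p) (Or.inl (by simp))).const_mul K
      refine h2.congr_deriv ?_
      rw [zero_mul, add_zero, Real.one_rpow]; ring
    -- The competitor `φ n + t ψ` has integral `1 + t c`, so by scaling its energy is at least `K (1
    -- + t c) ^ p`. In the limit the difference is nonnegative near `t = 0` and vanishes at `0`; its
    -- derivative there gives the Euler–Lagrange equation with multiplier `K`.
    have hmin : IsLocalMin (fun t : ℝ => (∫ x in Ω, ‖G x + t • ∇ ψ x‖ ^ p) - K * (1 + t * c) ^ p)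
        0 := by
      have hpos : ∀ᶠ t : ℝ in 𝓝 0, 0 < 1 + t * c := by
        have : ContinuousAt (fun t : ℝ => 1 + t * c) 0 := by fun_prop
        exact this.eventually (lt_mem_nhds (by simp))
      filter_upwards [hpos] with t ht
      simp only [zero_smul, add_zero, zero_mul, Real.one_rpow, mul_one, hGK, sub_self]
      rw [sub_nonneg]
      refine ge_of_tendsto' (hlim ψ hψ t) fun n => ?_
      have hI : ∫ x in Ω, (φ n + t • ψ) x = 1 + t * c := by
        simp only [Pi.add_apply, Pi.smul_apply, smul_eq_mul]
        rw [integral_add (hφ n).integrable.integrableOn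
          ((hψ.integrable.const_mul t).integrableOn), integral_const_mul, hφ1]
      have := hscale _ ((hφ n).add (hψ.const_smul t)) (hI ▸ ht)
      rwa [hI] at this
    have h0 := hmin.hasDerivAt_eq_zero (hd1.sub hd2)
    have : p * ((∫ x in Ω, ‖G x‖ ^ (p - 2) * inner ℝ (G x) (∇ ψ x)) - K * c) = 0 := by
      linarith
    have := (mul_eq_zero.1 this).resolve_left hp0.ne'
    linarith
  -- The operator is homogeneous of degree `p - 1`, so this rescaling turns the multiplier `K` into
  -- `1`.
  set c := K ^ (-(1 / (p - 1))) with hc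
  have hc0 : 0 < c := Real.rpow_pos_of_pos hK0 _
  have hcK : c ^ (p - 1) * K = 1 := by
    rw [hc, ← Real.rpow_mul hK0.le, neg_mul, one_div_mul_cancel (by linarith),
      Real.rpow_neg_one, inv_mul_cancel₀ hK0.ne']
  refine ⟨c • u, c • G, ?_, fun ψ hψ => ?_⟩
  · refine MemSobolevZero.of_tendsto hp hΩ (hu.const_smul c) (hG.const_smul c)
      (fun n => (hφ n).const_smul c) ?_ ?_
    · have := hul.const_mul |c|
      rw [mul_zero] at this
      refine this.congr fun n => ?_
      rw [← smul_sub, pNorm_const_smul hp]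
    · have := hGl.const_mul |c|
      rw [mul_zero] at this
      refine this.congr fun n => ?_
      rw [(hφ n).gradient_const_smul, ← smul_sub, pNorm_const_smul hp]
  · have e : ∀ x, ‖(c • G) x‖ ^ (p - 2) * inner ℝ ((c • G) x) (∇ ψ x) =
        c ^ (p - 1) * (‖G x‖ ^ (p - 2) * inner ℝ (G x) (∇ ψ x)) := by
      intro x
      rw [Pi.smul_apply, norm_smul, Real.norm_of_nonneg hc0.le,
        Real.mul_rpow hc0.le (norm_nonneg _), real_inner_smul_left]
      have : c ^ (p - 1) = c ^ (p - 2) * c := by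
        rw [← Real.rpow_add_one hc0.ne']; ring_nf
      rw [this]; ring
    simp only [e]
    rw [integral_const_mul, hEL ψ hψ, ← mul_assoc, hcK, one_mul]

lemma isTorsionFunction_torsionFunction (hΩ : IsConvexDomain Ω) (hD : 1 ≤ D) {p : ℝ}
    (hp : 1 < p) : IsTorsionFunction p Ω (torsionFunction p Ω) := by
  have h := hΩ.exists_isTorsionFunction hD hp
  rw [torsionFunction, dif_pos h]
  exact h.choose_spec

end IsConvexDomain

end Existence

/-! ### Variational characterization and scaling of the rigidity -/

section Variational

variable {D : ℕ} {Ω : Set (EuclideanSpace ℝ (Fin D))} {p : ℝ}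

/-- The optimal constant in `|∫ v| ≤ C ‖∇ v‖_p` over test functions `v`. -/
noncomputable def torsionConst (p : ℝ) (Ω : Set (EuclideanSpace ℝ (Fin D))) : ℝ :=
  torsionalRigidity p Ω ^ (1 - 1 / p)

/-- The scale-invariant quantity `δ(Ω) T(p; Ω) ^ (1 / p)`. -/
noncomputable def scaledRigidity (p : ℝ) (Ω : Set (EuclideanSpace ℝ (Fin D))) : ℝ :=
  avgDist Ω * (volume.real Ω ^ (1 - 1 / p) / torsionConst p Ω)

/-- Testing the equation with the approximating sequence gives the energy identity `∫ ‖G‖ ^ p = ∫ u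
= T`. Hölder in the weak formulation then yields the constant `‖G‖_p ^ (p - 1) = T ^ (1 - 1 / p)`,
and the same sequence shows that it is optimal: `T ≤ M T ^ (1 / p)`. The argument applies to any
weak solution, so uniqueness is not needed. -/
lemma IsTorsionFunction.variational (hp : 1 < p) (hΩ : IsConvexDomain Ω)
    {u : EuclideanSpace ℝ (Fin D) → ℝ} (hu : IsTorsionFunction p Ω u) :
    0 ≤ ∫ x in Ω, u x ∧
    (∀ ψ, IsTestFunction Ω ψ → |∫ x in Ω, ψ x| ≤
      (∫ x in Ω, u x) ^ (1 - 1 / p) * pNorm p (volume.restrict Ω) (∇ ψ)) ∧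
    ∀ M, (∀ ψ, IsTestFunction Ω ψ →
      |∫ x in Ω, ψ x| ≤ M * pNorm p (volume.restrict Ω) (∇ ψ)) → 0 < ∫ x in Ω, u x →
      (∫ x in Ω, u x) ^ (1 - 1 / p) ≤ M := by
  obtain ⟨G, ⟨⟨hu, hG, -⟩, φ, hφ, hφu, hφG⟩, heq⟩ := hu
  have hp0 : 0 < p := by linarith
  have : Fact (volume Ω < ⊤) := ⟨hΩ.volume_ne_top.lt_top⟩
  set μ := volume.restrict Ω with hμ
  set T := ∫ x in Ω, u x with hT
  have l1 : Tendsto (fun n => pNorm p μ (φ n - u)) atTop (𝓝 0) := by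
    have := (ENNReal.tendsto_toReal ENNReal.zero_ne_top).comp hφu
    exact this.congr fun n => (pNorm_eq_toReal hp (((hφ n).memLp _).sub hu)).symm
  have l2 : Tendsto (fun n => pNorm p μ (∇ (φ n) - G)) atTop (𝓝 0) := by
    have := (ENNReal.tendsto_toReal ENNReal.zero_ne_top).comp hφG
    exact this.congr fun n => (pNorm_eq_toReal hp (((hφ n).memLp_gradient _).sub hG)).symm
  have l3 : Tendsto (fun n => ∫ x in Ω, φ n x) atTop (𝓝 T) := by
    rw [tendsto_iff_norm_sub_tendsto_zero]
    refine squeeze_zero (fun _ => norm_nonneg _) (fun n => ?_)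
      (by simpa only [mul_zero] using l1.const_mul (μ.real Set.univ ^ (1 - 1 / p)))
    have i1 := ((hφ n).memLp (Ω := Ω) (ENNReal.ofReal p)).integrable (one_le_ofReal_of_one_lt hp)
    have i2 := hu.integrable (one_le_ofReal_of_one_lt hp)
    rw [hT, ← integral_sub i1 i2]
    exact (norm_integral_le_integral_norm _).trans
      (integral_norm_le_pNorm hp (((hφ n).memLp _).sub hu))
  have l4 : Tendsto (fun n => ∫ x in Ω, ‖G x‖ ^ (p - 2) * inner ℝ (G x) (∇ (φ n) x)) atTop
      (𝓝 (∫ x in Ω, ‖G x‖ ^ p)) := by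
    rw [tendsto_iff_norm_sub_tendsto_zero]
    refine squeeze_zero (fun _ => norm_nonneg _) (fun n => ?_)
      (by simpa using l2.const_mul (pNorm p μ G ^ (p - 1)))
    have h := abs_integral_norm_rpow_mul_inner_le hp hG (((hφ n).memLp_gradient _).sub hG)
    refine le_trans (le_of_eq ?_) h
    rw [Real.norm_eq_abs, ← integral_sub (integrable_norm_rpow_mul_inner hp hG
      ((hφ n).memLp_gradient _)) (integrable_norm_rpow hp hG)]
    congr 2
    funext x
    rw [← norm_rpow_mul_inner_self hp, Pi.sub_apply, inner_sub_right]
    ring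
  have hE : ∫ x in Ω, ‖G x‖ ^ p = T :=
    tendsto_nhds_unique l4 (l3.congr fun n => (heq _ (hφ n)).symm)
  have hT0 : 0 ≤ T := hE ▸ integral_norm_rpow_nonneg G
  have hGT : pNorm p μ G = T ^ (1 / p) := by rw [pNorm, hE]
  refine ⟨hT0, fun ψ hψ => ?_, fun M hM hTpos => ?_⟩
  · rw [← heq ψ hψ]
    have h := abs_integral_norm_rpow_mul_inner_le hp hG (hψ.memLp_gradient (Ω := Ω) _)
    rw [hGT, ← Real.rpow_mul hT0] at h
    convert h using 3
    field_simp
  · have h1 : T ≤ M * T ^ (1 / p) := by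
      rw [← hGT]
      exact le_of_tendsto_of_tendsto' l3 ((tendsto_pNorm hp (fun n => (hφ n).memLp_gradient _) hG
        l2).const_mul M) fun n => (le_abs_self _).trans (hM _ (hφ n))
    have h2 : T = T ^ (1 - 1 / p) * T ^ (1 / p) := by
      rw [← Real.rpow_add hTpos]; simp
    refine le_of_mul_le_mul_right ?_ (Real.rpow_pos_of_pos hTpos (1 / p))
    rwa [← h2]

namespace IsConvexDomain

/-- With `T = 0` the optimal constant would be `0`, contradicting a test function of integral one.
-/
lemma torsionalRigidity_pos (hΩ : IsConvexDomain Ω) (hD : 1 ≤ D) (hp : 1 < p) :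
    0 < torsionalRigidity p Ω := by
  obtain ⟨h0, h1, -⟩ := (hΩ.isTorsionFunction_torsionFunction hD hp).variational hp hΩ
  obtain ⟨φ, hφ, hφ1⟩ := hΩ.exists_isTestFunction
  refine lt_of_le_of_ne h0 fun h => ?_
  have h2 := h1 φ hφ
  have hpe : 1 - 1 / p ≠ 0 := by
    have : 1 / p < 1 := by rw [div_lt_one (by linarith)]; exact hp
    linarith
  rw [torsionalRigidity] at h
  rw [← h, hφ1, Real.zero_rpow hpe] at h2
  norm_num at h2

lemma torsionConst_pos (hΩ : IsConvexDomain Ω) (hD : 1 ≤ D) (hp : 1 < p) :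
    0 < torsionConst p Ω := Real.rpow_pos_of_pos (hΩ.torsionalRigidity_pos hD hp) _

lemma abs_setIntegral_le_torsionConst (hΩ : IsConvexDomain Ω) (hD : 1 ≤ D) (hp : 1 < p)
    {ψ : EuclideanSpace ℝ (Fin D) → ℝ} (hψ : IsTestFunction Ω ψ) :
    |∫ x in Ω, ψ x| ≤ torsionConst p Ω * pNorm p (volume.restrict Ω) (∇ ψ) :=
  ((hΩ.isTorsionFunction_torsionFunction hD hp).variational hp hΩ).2.1 ψ hψ

lemma torsionConst_le (hΩ : IsConvexDomain Ω) (hD : 1 ≤ D) (hp : 1 < p) {M : ℝ}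
    (hM : ∀ ψ, IsTestFunction Ω ψ →
      |∫ x in Ω, ψ x| ≤ M * pNorm p (volume.restrict Ω) (∇ ψ)) : torsionConst p Ω ≤ M :=
  ((hΩ.isTorsionFunction_torsionFunction hD hp).variational hp hΩ).2.2 M hM
    (hΩ.torsionalRigidity_pos hD hp)

lemma scaledRigidity_pos (hΩ : IsConvexDomain Ω) (hD : 1 ≤ D) (hp : 1 < p) :
    0 < scaledRigidity p Ω :=
  mul_pos (hΩ.avgDist_pos hD)
    (div_pos (Real.rpow_pos_of_pos hΩ.volume_real_pos _) (hΩ.torsionConst_pos hD hp))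

/-- Reduces every comparison at fixed average distance to a comparison of scale-invariant
quantities. -/
lemma normalizedRigidity_eq (hΩ : IsConvexDomain Ω) (hD : 1 ≤ D) (hp : 1 < p) :
    normalizedRigidity p Ω = (scaledRigidity p Ω / avgDist Ω) ^ p := by
  have hT := hΩ.torsionalRigidity_pos hD hp
  have hp0 : p ≠ 0 := by linarith
  rw [scaledRigidity, mul_div_cancel_left₀ _ (hΩ.avgDist_pos hD).ne', normalizedRigidity,
    torsionConst, Real.div_rpow (by positivity) (by positivity),
    ← Real.rpow_mul hΩ.volume_real_pos.le, ← Real.rpow_mul hT.le, div_eq_mul_inv,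
    ← Real.rpow_neg hT.le]
  congr 2
  · field_simp
  · field_simp
    ring

lemma one_div_le_scaledRigidity (hΩ : IsConvexDomain Ω) (hD : 1 ≤ D) (hp : 1 < p) :
    1 / ((D : ℝ) + 1) ≤ scaledRigidity p Ω := by
  have h := hΩ.torsionConst_le hD hp fun ψ hψ => hΩ.abs_setIntegral_le hD hp hψ
  rw [scaledRigidity, mul_div_assoc', div_le_div_iff₀ (by positivity) (hΩ.torsionConst_pos hD hp)]
  linarith

lemma smul (hΩ : IsConvexDomain Ω) {c : ℝ} (hc : 0 < c) : IsConvexDomain (c • Ω) :=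
  ⟨hΩ.nonempty.smul_set, hΩ.isOpen.smul₀ hc.ne', hΩ.isBounded.smul₀ c, hΩ.convex.smul c⟩

lemma volume_real_smul {c : ℝ} (hc : 0 < c) (Ω : Set (EuclideanSpace ℝ (Fin D))) :
    volume.real (c • Ω) = c ^ D * volume.real Ω := by
  rw [Measure.real, Measure.addHaar_smul_of_nonneg _ hc.le, finrank_euclideanSpace_fin,
    ENNReal.toReal_mul, ENNReal.toReal_ofReal (by positivity), Measure.real]

lemma setIntegral_smul {c : ℝ} (hc : 0 < c) (Ω : Set (EuclideanSpace ℝ (Fin D)))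
    (f : EuclideanSpace ℝ (Fin D) → ℝ) :
    ∫ x in c • Ω, f x = c ^ D * ∫ x in Ω, f (c • x) := by
  rw [Measure.setIntegral_comp_smul_of_pos _ _ _ hc, finrank_euclideanSpace_fin, smul_eq_mul,
    mul_inv_cancel_left₀ (by positivity)]

lemma avgDist_smul {c : ℝ} (hc : 0 < c) (Ω : Set (EuclideanSpace ℝ (Fin D))) :
    avgDist (c • Ω) = c * avgDist Ω := by
  have hfr : frontier (c • Ω) = c • frontier Ω := by
    exact ((Homeomorph.smulOfNeZero c hc.ne').image_frontier Ω).symm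
  have e : ∀ x, Metric.infDist (c • x) (c • frontier Ω) = c * Metric.infDist x (frontier Ω) := by
    intro x
    rw [infDist_smul₀ hc.ne', Real.norm_of_nonneg hc.le]
  rw [avgDist, avgDist, volume_real_smul hc, setIntegral_smul hc, hfr]
  simp only [e]
  rw [integral_const_mul, mul_inv]
  have : (c ^ D)⁻¹ * c ^ D = 1 := inv_mul_cancel₀ (by positivity)
  linear_combination c * (volume.real Ω)⁻¹ * (∫ x in Ω, Metric.infDist x (frontier Ω)) * this

/-- Pull a test function back by the dilation: integrals contribute `c ^ D`, the gradient a factor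
`c`, and its `L^p` norm `c ^ (D / p)`. Dilating back by `c⁻¹` gives the reverse inequality. -/
lemma torsionConst_smul_le (hΩ : IsConvexDomain Ω) (hD : 1 ≤ D) (hp : 1 < p) {c : ℝ}
    (hc : 0 < c) :
    torsionConst p (c • Ω) ≤ c ^ (1 + D - D / p) * torsionConst p Ω := by
  have hp0 : 0 < p := by linarith
  refine (hΩ.smul hc).torsionConst_le hD hp fun ψ hψ => ?_
  set w : EuclideanSpace ℝ (Fin D) → ℝ := fun x => ψ (c • x) with hw
  have hcs : HasCompactSupport w :=
    hψ.hasCompactSupport.comp_homeomorph (Homeomorph.smulOfNeZero c hc.ne')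
  have hw1 : IsTestFunction Ω w := by
    refine ⟨hψ.contDiff.comp (contDiff_const_smul c), hcs, ?_⟩
    have hcl : IsClosed ((fun x : EuclideanSpace ℝ (Fin D) => c • x) ⁻¹' tsupport ψ) :=
      (isClosed_tsupport ψ).preimage (continuous_const_smul c)
    have hsub : Function.support w ⊆ (fun x => c • x) ⁻¹' tsupport ψ :=
      fun x hx => subset_tsupport ψ hx
    refine (closure_minimal hsub hcl).trans fun x hx => ?_
    exact (Set.smul_mem_smul_set_iff₀ hc.ne' _ _).1 (hψ.tsupport_subset hx)
  have hgrad : ∀ x, ∇ w x = c • ∇ ψ (c • x) := by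
    intro x
    simp only [gradient]
    rw [hw, fderiv_comp_smul, map_smul]
  have h := hΩ.abs_setIntegral_le_torsionConst hD hp hw1
  have e1 : pNorm p (volume.restrict (c • Ω)) (∇ ψ) =
      c ^ (D / p) * (c⁻¹ * pNorm p (volume.restrict Ω) (∇ w)) := by
    have h2 : ∀ x, ‖∇ w x‖ ^ p = c ^ p * ‖∇ ψ (c • x)‖ ^ p := fun x => by
      rw [hgrad, norm_smul, Real.norm_of_nonneg hc.le, Real.mul_rpow hc.le (norm_nonneg _)]
    have hI : 0 ≤ ∫ x in Ω, ‖∇ ψ (c • x)‖ ^ p := integral_norm_rpow_nonneg fun x => ∇ ψ (c • x)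
    simp only [pNorm, h2]
    rw [setIntegral_smul hc, integral_const_mul, Real.mul_rpow (by positivity) hI,
      Real.mul_rpow (by positivity) hI, ← Real.rpow_mul hc.le, mul_one_div_cancel hp0.ne',
      Real.rpow_one, inv_mul_cancel_left₀ hc.ne', ← Real.rpow_natCast, ← Real.rpow_mul hc.le,
      mul_one_div]
  have e2 : c ^ (1 + D - D / p) = c * c ^ D / c ^ (D / p) := by
    rw [Real.rpow_sub hc, Real.rpow_add hc, Real.rpow_one, Real.rpow_natCast]
  rw [setIntegral_smul hc, abs_mul, abs_of_pos (by positivity : 0 < c ^ D), e1, e2]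
  refine (mul_le_mul_of_nonneg_left h (by positivity)).trans (le_of_eq ?_)
  have : 0 < c ^ (D / p) := Real.rpow_pos_of_pos hc _
  field_simp

lemma torsionConst_smul (hΩ : IsConvexDomain Ω) (hD : 1 ≤ D) (hp : 1 < p) {c : ℝ}
    (hc : 0 < c) : torsionConst p (c • Ω) = c ^ (1 + D - D / p) * torsionConst p Ω := by
  refine le_antisymm (hΩ.torsionConst_smul_le hD hp hc) ?_
  have h := (hΩ.smul hc).torsionConst_smul_le hD hp (inv_pos.2 hc)
  rw [inv_smul_smul₀ hc.ne', Real.inv_rpow hc.le,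
    le_inv_mul_iff₀ (Real.rpow_pos_of_pos hc _)] at h
  exact h

lemma scaledRigidity_smul (hΩ : IsConvexDomain Ω) (hD : 1 ≤ D) (hp : 1 < p) {c : ℝ}
    (hc : 0 < c) : scaledRigidity p (c • Ω) = scaledRigidity p Ω := by
  have hV := hΩ.volume_real_pos
  have e : c ^ (1 + D - D / p) = c * (c ^ D) ^ (1 - 1 / p) := by
    rw [← Real.rpow_natCast, ← Real.rpow_mul hc.le, ← Real.rpow_one_add' hc.le]
    · ring_nf
    · have : 1 / p < 1 := by rw [div_lt_one (by linarith)]; exact hp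
      have : 0 ≤ (D : ℝ) * (1 - 1 / p) := mul_nonneg (by positivity) (by linarith)
      positivity
  have := hΩ.torsionConst_pos hD hp
  rw [scaledRigidity, scaledRigidity, avgDist_smul hc, volume_real_smul hc,
    hΩ.torsionConst_smul hD hp hc, e, Real.mul_rpow (by positivity) hV.le]
  field_simp

end IsConvexDomain

end Variational

/-! ### Competitors built from the distance to the boundary -/

section DistanceFunctions

variable {D : ℕ} {Ω : Set (EuclideanSpace ℝ (Fin D))} {p : ℝ}

/-- Mollification of a compactly supported Lipschitz function. -/
lemma exists_isTestFunction_of_lipschitz (hΩ : IsOpen Ω) {g : EuclideanSpace ℝ (Fin D) → ℝ}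
    {K : NNReal} (hg : LipschitzWith K g) (hgc : HasCompactSupport g) (hgs : tsupport g ⊆ Ω)
    {η : ℝ} (hη : 0 < η) :
    ∃ v, IsTestFunction Ω v ∧ (∀ x, ‖∇ v x‖ ≤ K) ∧ ∫ x, v x = ∫ x, g x ∧
      ∀ x, (∀ y ∈ Metric.ball x η, g y = g x) → ∇ v x = 0 := by
  obtain ⟨r, hr, hrΩ⟩ := hgc.isCompact.exists_cthickening_subset_open hΩ hgs
  have hm : 0 < min r η := lt_min hr hη
  -- Radius below `r` keeps the support inside `Ω`; radius below `η` keeps the mollification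
  -- constant near points about which `g` is constant.
  let φ : ContDiffBump (0 : EuclideanSpace ℝ (Fin D)) :=
    ⟨min r η / 4, min r η / 2, by positivity, by linarith⟩
  have hφr : φ.rOut < r := (half_lt_self hm).trans_le (min_le_left _ _)
  have hφη : φ.rOut < η := (half_lt_self hm).trans_le (min_le_right _ _)
  have hφi : Integrable (φ.normed volume) := φ.integrable_normed
  have hgi : Integrable g := hg.continuous.integrable_of_hasCompactSupport hgc
  set v := convolution (φ.normed volume) g (ContinuousLinearMap.lsmul ℝ ℝ) volume with hv
  have hvd : ContDiff ℝ ∞ v :=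
    φ.hasCompactSupport_normed.contDiff_convolution_left _ φ.contDiff_normed hgi.locallyIntegrable
  have hvc : HasCompactSupport v := φ.hasCompactSupport_normed.convolution _ hgc
  have hvs : tsupport v ⊆ Ω := by
    refine (closure_minimal (fun x hx => ?_) Metric.isClosed_cthickening).trans hrΩ
    obtain ⟨y, hy, z, hz, rfl⟩ := support_convolution_subset_swap _ hx
    rw [φ.support_normed_eq, mem_ball_zero_iff] at hz
    refine Metric.mem_cthickening_of_dist_le _ y _ _ (subset_tsupport g hy) ?_
    simp only [dist_self_add_left]
    linarith
  have hint : ∀ x, Integrable fun t => φ.normed volume t * g (x - t) := by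
    intro x
    refine Continuous.integrable_of_hasCompactSupport ?_ φ.hasCompactSupport_normed.mul_right
    exact φ.continuous_normed.mul (hg.continuous.comp (by fun_prop))
  have hlip : LipschitzWith K v := by
    refine LipschitzWith.of_dist_le_mul fun x y => ?_
    have h1 : v x - v y = ∫ t, φ.normed volume t * (g (x - t) - g (y - t)) := by
      simp only [mul_sub]
      rw [integral_sub (hint x) (hint y)]
      rfl
    rw [dist_eq_norm, h1, ← one_mul (K * dist x y), ← φ.integral_normed (μ := volume),
      ← integral_mul_const]
    refine norm_integral_le_of_norm_le (hφi.mul_const _) (Eventually.of_forall fun t => ?_)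
    rw [norm_mul, Real.norm_of_nonneg (φ.nonneg_normed t)]
    refine mul_le_mul_of_nonneg_left ?_ (φ.nonneg_normed t)
    have := hg.dist_le_mul (x - t) (y - t)
    rwa [dist_sub_right, Real.dist_eq] at this
  refine ⟨v, ⟨hvd, hvc, hvs⟩, fun x => ?_, ?_, fun x hx => ?_⟩
  · rw [norm_gradient]
    exact norm_fderiv_le_of_lipschitz ℝ hlip
  · rw [hv, integral_convolution _ hφi hgi, φ.integral_normed]
    simp
  · have hev : v =ᶠ[𝓝 x] fun _ => g x := by
      filter_upwards [Metric.ball_mem_nhds x (sub_pos.2 hφη)] with y hy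
      have hyx : g y = g x := hx y (Metric.ball_subset_ball
        (sub_le_self _ φ.rOut_pos.le) hy)
      rw [hv, φ.normed_convolution_eq_right, hyx]
      intro z hz
      rw [hyx]
      refine hx z ?_
      rw [Metric.mem_ball] at hz hy ⊢
      linarith [dist_triangle z y x]
    rw [hev.gradient_eq, gradient_fun_const]

namespace IsConvexDomain

/-- The distance to the complement vanishes outside `Ω` and is Lipschitz on the whole space, so
profiles of it extend by zero; the distance to the frontier does not vanish outside. -/
lemma infDist_compl_eq (hΩ : IsConvexDomain Ω) (hD : 1 ≤ D) {x : EuclideanSpace ℝ (Fin D)}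
    (hx : x ∈ Ω) : Metric.infDist x Ωᶜ = Metric.infDist x (frontier Ω) := by
  have hsub : frontier Ω ⊆ Ωᶜ := fun y hy hy' =>
    Set.disjoint_left.1 (Set.disjoint_iff_inter_eq_empty.2 hΩ.isOpen.inter_frontier_eq) hy' hy
  have hne := hΩ.frontier_nonempty hD
  refine le_antisymm (Metric.infDist_le_infDist_of_subset hsub hne) ?_
  rw [Metric.le_infDist (hne.mono hsub)]
  intro y hy
  by_contra hlt
  rw [not_le, dist_comm] at hlt
  exact hy (hΩ.ball_infDist_subset hx hlt)

/-- Test functions that are mollified functions of the distance to the boundary. -/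
lemma exists_isTestFunction_of_profile (hΩ : IsConvexDomain Ω) (hD : 1 ≤ D) {h : ℝ → ℝ}
    {K : NNReal} (hh : LipschitzWith K h) {ε : ℝ} (hε : 0 < ε) (h0 : ∀ t ≤ ε, h t = 0)
    {η : ℝ} (hη : 0 < η) :
    ∃ v, IsTestFunction Ω v ∧ (∀ x, ‖∇ v x‖ ≤ K) ∧
      ∫ x in Ω, v x = ∫ x in Ω, h (Metric.infDist x (frontier Ω)) ∧
      ∀ x, (∀ y ∈ Metric.ball x η, h (Metric.infDist y Ωᶜ) = h (Metric.infDist x Ωᶜ)) →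
        ∇ v x = 0 := by
  set g : EuclideanSpace ℝ (Fin D) → ℝ := fun x => h (Metric.infDist x Ωᶜ) with hg
  have hgl : LipschitzWith K g := by
    have := hh.comp (Metric.lipschitz_infDist_pt (Ωᶜ))
    rwa [mul_one] at this
  set S : Set (EuclideanSpace ℝ (Fin D)) := {x | ε ≤ Metric.infDist x Ωᶜ} with hS
  have hSc : IsClosed S := isClosed_le continuous_const (Metric.continuous_infDist_pt _)
  have hSΩ : S ⊆ Ω := by
    intro x hx
    by_contra hxΩ
    have : Metric.infDist x Ωᶜ = 0 := Metric.infDist_zero_of_mem hxΩ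
    simp only [hS, Set.mem_ofPred_eq, this] at hx
    linarith
  have hgS : tsupport g ⊆ S := closure_minimal (fun x hx => by
    by_contra hxS
    exact hx (h0 _ (not_le.1 hxS).le)) hSc
  have hgc : HasCompactSupport g :=
    HasCompactSupport.of_support_subset_isCompact
      (Metric.isCompact_of_isClosed_isBounded hSc (hΩ.isBounded.subset hSΩ))
      ((subset_tsupport g).trans hgS)
  obtain ⟨v, hv, hvK, hvI, hv0⟩ :=
    exists_isTestFunction_of_lipschitz hΩ.isOpen hgl hgc (hgS.trans hSΩ) hη
  refine ⟨v, hv, hvK, ?_, hv0⟩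
  rw [hv.setIntegral_eq, hvI, ← setIntegral_eq_integral_of_forall_compl_eq_zero (s := Ω)]
  · refine setIntegral_congr_fun hΩ.isOpen.measurableSet fun x hx => ?_
    simp only [hg]
    rw [hΩ.infDist_compl_eq hD hx]
  · intro x hx
    simp only [hg]
    rw [Metric.infDist_zero_of_mem (by exact hx)]
    exact h0 0 hε.le

lemma avgDist_mul_volume (hΩ : IsConvexDomain Ω) :
    ∫ x in Ω, Metric.infDist x (frontier Ω) = avgDist Ω * volume.real Ω := by
  rw [avgDist, mul_comm, mul_inv_cancel_left₀ hΩ.volume_real_pos.ne']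

/-- The distance to the boundary is admissible in the variational problem. -/
lemma scaledRigidity_le_one (hΩ : IsConvexDomain Ω) (hD : 1 ≤ D) (hp : 1 < p) :
    scaledRigidity p Ω ≤ 1 := by
  have hp0 : 0 < p := by linarith
  have hV := hΩ.volume_real_pos
  have hM := hΩ.torsionConst_pos hD hp
  have : Fact (volume Ω < ⊤) := ⟨hΩ.volume_ne_top.lt_top⟩
  have key : ∀ ε > 0, avgDist Ω * volume.real Ω ≤
      torsionConst p Ω * volume.real Ω ^ (1 / p) + ε * volume.real Ω := by
    intro ε hε
    -- Truncating the distance at level `ε` gives compact support and costs at most `ε |Ω|` in the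
    -- integral.
    have hh : LipschitzWith 1 fun t : ℝ => max (t - ε) 0 :=
      LipschitzWith.of_dist_le_mul fun s t => by
        rw [NNReal.coe_one, one_mul, Real.dist_eq, Real.dist_eq]
        refine (abs_max_sub_max_le_abs _ _ _).trans (le_of_eq ?_)
        ring_nf
    obtain ⟨v, hv, hvK, hvI, -⟩ := hΩ.exists_isTestFunction_of_profile hD hh hε
      (fun t ht => max_eq_right (by linarith)) one_pos
    have h1 := (le_abs_self _).trans (hΩ.abs_setIntegral_le_torsionConst hD hp hv)
    have h2 : pNorm p (volume.restrict Ω) (∇ v) ≤ volume.real Ω ^ (1 / p) := by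
      refine Real.rpow_le_rpow (integral_norm_rpow_nonneg _) ?_ (by positivity)
      have h3 : ∫ x in Ω, ‖∇ v x‖ ^ p ≤ ∫ x in Ω, (1 : ℝ) :=
        integral_mono (integrable_norm_rpow hp (hv.memLp_gradient _)) (integrable_const 1)
          fun x => Real.rpow_le_one (norm_nonneg _) (hvK x) hp0.le
      simpa using h3
    have i1 : IntegrableOn (fun x => Metric.infDist x (frontier Ω) - ε) Ω :=
      hΩ.integrableOn_of_continuous ((Metric.continuous_infDist_pt _).sub continuous_const)
    have i2 : IntegrableOn (fun x => max (Metric.infDist x (frontier Ω) - ε) 0) Ω :=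
      hΩ.integrableOn_of_continuous
        (((Metric.continuous_infDist_pt _).sub continuous_const).max continuous_const)
    have h4 : avgDist Ω * volume.real Ω - ε * volume.real Ω ≤ ∫ x in Ω, v x := by
      rw [hvI]
      refine le_trans (le_of_eq ?_) (integral_mono i1 i2 fun x => le_max_left _ _)
      rw [integral_sub (hΩ.integrableOn_of_continuous (Metric.continuous_infDist_pt _))
        (integrable_const ε), hΩ.avgDist_mul_volume]
      simp [mul_comm]
    have h5 := mul_le_mul_of_nonneg_left h2 hM.le
    linarith
  have h6 : avgDist Ω * volume.real Ω ≤ torsionConst p Ω * volume.real Ω ^ (1 / p) := by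
    refine le_of_forall_pos_le_add fun e he => ?_
    have := key (e / volume.real Ω) (by positivity)
    rwa [div_mul_cancel₀ _ hV.ne'] at this
  rw [scaledRigidity, mul_div_assoc', div_le_one hM]
  have h7 : volume.real Ω = volume.real Ω ^ (1 - 1 / p) * volume.real Ω ^ (1 / p) := by
    rw [← Real.rpow_add hV]; simp
  refine le_of_mul_le_mul_right ?_ (Real.rpow_pos_of_pos hV (1 / p))
  calc _ = avgDist Ω * volume.real Ω := by rw [mul_assoc, ← h7]
    _ ≤ _ := h6

/-- A bound from the test function that grows linearly from the boundary up to height one at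
distance `s`. -/
lemma volume_level_le (hΩ : IsConvexDomain Ω) (hD : 1 ≤ D) (hp : 1 < p) {s : ℝ} (hs : 0 < s) :
    s * volume.real (Ω ∩ {x | s ≤ Metric.infDist x (frontier Ω)}) ≤ torsionConst p Ω *
      volume.real (Ω ∩ {x | Metric.infDist x (frontier Ω) < s}) ^ (1 / p) := by
  have hp0 : 0 < p := by linarith
  have hM := hΩ.torsionConst_pos hD hp
  have : Fact (volume Ω < ⊤) := ⟨hΩ.volume_ne_top.lt_top⟩
  have hdm : Measurable fun x : EuclideanSpace ℝ (Fin D) => Metric.infDist x (frontier Ω) :=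
    (Metric.continuous_infDist_pt _).measurable
  set A := Ω ∩ {x | s ≤ Metric.infDist x (frontier Ω)} with hA
  set B := Ω ∩ {x | Metric.infDist x (frontier Ω) < s} with hB
  have hAm : MeasurableSet A := hΩ.isOpen.measurableSet.inter (measurableSet_le measurable_const hdm)
  have hBm : MeasurableSet B := hΩ.isOpen.measurableSet.inter (measurableSet_lt hdm measurable_const)
  have key : ∀ s', 0 < s' → s' < s → s' * volume.real A ≤
      torsionConst p Ω * volume.real B ^ (1 / p) := by
    intro s' hs' hss
    -- A zero layer of width `ε`, then slope `1 / s'` up to height one at `s' + ε`. Since `s = s' +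
    -- 3 ε`, mollifying at scale `ε` leaves the gradient zero where the distance is at least `s`.
    set ε := (s - s') / 3 with hε
    have hε0 : 0 < ε := by rw [hε]; linarith
    set K : NNReal := ⟨s'⁻¹, (inv_pos.2 hs').le⟩ with hK
    set h : ℝ → ℝ := fun t => min (max (s'⁻¹ * (t - ε)) 0) 1 with hh
    have hhl : LipschitzWith K h :=
      LipschitzWith.of_dist_le_mul fun x y => by
        rw [Real.dist_eq, Real.dist_eq]
        refine (abs_inf_sub_inf_le_abs _ _ _).trans ((abs_max_sub_max_le_abs _ _ _).trans
          (le_of_eq ?_))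
        rw [← mul_sub, abs_mul, abs_of_pos (inv_pos.2 hs'), sub_sub_sub_cancel_right]
        rfl
    have hh0 : ∀ t ≤ ε, h t = 0 := fun t ht => by
      have : s'⁻¹ * (t - ε) ≤ 0 := mul_nonpos_of_nonneg_of_nonpos (inv_pos.2 hs').le (by linarith)
      simp only [hh]; rw [max_eq_right this, min_eq_left zero_le_one]
    have hh1 : ∀ t, s' + ε ≤ t → h t = 1 := fun t ht => by
      have : 1 ≤ s'⁻¹ * (t - ε) := by
        rw [le_inv_mul_iff₀ hs']; linarith
      exact min_eq_right (this.trans (le_max_left _ _))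
    have hhnn : ∀ t, 0 ≤ h t := fun t => le_min (le_max_right _ _) zero_le_one
    obtain ⟨v, hv, hvK, hvI, hv0⟩ := hΩ.exists_isTestFunction_of_profile hD hhl hε0 hh0 hε0
    have h1 := (le_abs_self _).trans (hΩ.abs_setIntegral_le_torsionConst hD hp hv)
    have h2 : volume.real A ≤ ∫ x in Ω, v x := by
      rw [hvI]
      have i1 : IntegrableOn (fun x => h (Metric.infDist x (frontier Ω))) Ω :=
        hΩ.integrableOn_of_continuous (hhl.continuous.comp (Metric.continuous_infDist_pt _))
      have h3 : ∫ x in A, h (Metric.infDist x (frontier Ω)) = volume.real A := by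
        rw [setIntegral_congr_fun hAm (g := fun _ => (1 : ℝ)) fun x hx => hh1 _ ?_]
        · simp
        · have : s ≤ Metric.infDist x (frontier Ω) := hx.2
          linarith
      rw [← h3]
      exact setIntegral_mono_set i1 (Eventually.of_forall fun x => hhnn _)
        (Set.inter_subset_left).eventuallyLE
    have hgrad : ∀ x ∈ Ω, x ∉ B → ∇ v x = 0 := by
      intro x hx hxB
      have hxs : s ≤ Metric.infDist x Ωᶜ := by
        rw [hΩ.infDist_compl_eq hD hx]
        by_contra hlt
        exact hxB ⟨hx, not_le.1 hlt⟩
      refine hv0 x fun y hy => ?_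
      have h4 : Metric.infDist x Ωᶜ ≤ Metric.infDist y Ωᶜ + dist x y := Metric.infDist_le_infDist_add_dist
      rw [Metric.mem_ball, dist_comm] at hy
      rw [hh1 _ (by linarith), hh1 _ (by linarith)]
    have h5 : pNorm p (volume.restrict Ω) (∇ v) ≤ s'⁻¹ * volume.real B ^ (1 / p) := by
      have h6 : ∫ x in Ω, ‖∇ v x‖ ^ p ≤ s'⁻¹ ^ p * volume.real B := by
        calc ∫ x in Ω, ‖∇ v x‖ ^ p = ∫ x in B, ‖∇ v x‖ ^ p := by
              refine setIntegral_eq_of_subset_of_forall_sdiff_eq_zero hΩ.isOpen.measurableSet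
                Set.inter_subset_left fun x hx => ?_
              rw [hgrad x hx.1 hx.2, norm_zero, Real.zero_rpow hp0.ne']
          _ ≤ ∫ x in B, s'⁻¹ ^ p := by
              refine integral_mono ((integrable_norm_rpow hp (hv.memLp_gradient _)).mono_measure
                (Measure.restrict_mono_set _ Set.inter_subset_left)) ?_ fun x =>
                Real.rpow_le_rpow (norm_nonneg _) (hvK x) hp0.le
              have : Fact (volume B < ⊤) :=
                ⟨(measure_mono Set.inter_subset_left).trans_lt hΩ.volume_ne_top.lt_top⟩
              exact integrable_const _
          _ = s'⁻¹ ^ p * volume.real B := by simp [mul_comm]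
      have h7 := Real.rpow_le_rpow (integral_norm_rpow_nonneg _) h6
        (by positivity : 0 ≤ 1 / p)
      rwa [Real.mul_rpow (by positivity) measureReal_nonneg, ← Real.rpow_mul (by positivity),
        mul_one_div_cancel hp0.ne', Real.rpow_one] at h7
    have h8 := (h2.trans h1).trans (mul_le_mul_of_nonneg_left h5 hM.le)
    have h9 := mul_le_mul_of_nonneg_left h8 hs'.le
    refine h9.trans (le_of_eq ?_)
    field_simp
  have hcont : Tendsto (fun s' : ℝ => s' * volume.real A) (𝓝[<] s) (𝓝 (s * volume.real A)) :=
    ((continuous_id.mul continuous_const).tendsto s).mono_left nhdsWithin_le_nhds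
  refine le_of_tendsto hcont ?_
  filter_upwards [Ioo_mem_nhdsLT hs] with s' hs'
  exact key s' hs'.1 hs'.2

/-- Here `κ` bounds the volume fraction of the boundary layer of width `s`. For a thin slab of
half-width one, `δ ≈ 1 / 2` and `κ ≈ s`, so the bound approaches `1 / 2` as `p → 1` and `s → 0`. -/
lemma scaledRigidity_le_of_volume_level (hΩ : IsConvexDomain Ω) (hD : 1 ≤ D) (hp : 1 < p)
    {s κ : ℝ} (hs : 0 < s) (hκ0 : 0 ≤ κ) (hκ1 : κ < 1)
    (hκ : (1 - κ) * volume.real Ω ≤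
      volume.real (Ω ∩ {x | s ≤ Metric.infDist x (frontier Ω)})) :
    scaledRigidity p Ω ≤ avgDist Ω * (κ ^ (1 / p) / (s * (1 - κ))) := by
  have hp0 : 0 < p := by linarith
  have hV := hΩ.volume_real_pos
  have hM := hΩ.torsionConst_pos hD hp
  have h1 := hΩ.volume_level_le hD hp hs
  have hdm : Measurable fun x : EuclideanSpace ℝ (Fin D) => Metric.infDist x (frontier Ω) :=
    (Metric.continuous_infDist_pt _).measurable
  have h2 : volume.real (Ω ∩ {x | Metric.infDist x (frontier Ω) < s}) ≤ κ * volume.real Ω := by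
    have h3 := measureReal_inter_add_sdiff (μ := volume) (s := Ω)
      (measurableSet_le measurable_const hdm : MeasurableSet {x | s ≤ Metric.infDist x (frontier Ω)})
      hΩ.volume_ne_top
    have h4 : Ω \ {x | s ≤ Metric.infDist x (frontier Ω)} =
        Ω ∩ {x | Metric.infDist x (frontier Ω) < s} := by
      ext x; simp
    rw [h4] at h3
    linarith
  have h5 := Real.rpow_le_rpow measureReal_nonneg h2 (by positivity : 0 ≤ 1 / p)
  rw [Real.mul_rpow hκ0 hV.le] at h5
  have h6 : s * ((1 - κ) * volume.real Ω) ≤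
      torsionConst p Ω * (κ ^ (1 / p) * volume.real Ω ^ (1 / p)) :=
    (mul_le_mul_of_nonneg_left hκ hs.le).trans (h1.trans (mul_le_mul_of_nonneg_left h5 hM.le))
  rw [scaledRigidity]
  refine mul_le_mul_of_nonneg_left ?_ (hΩ.avgDist_pos hD).le
  have hκ' : 0 < 1 - κ := by linarith
  rw [div_le_div_iff₀ hM (by positivity)]
  have h7 : volume.real Ω = volume.real Ω ^ (1 - 1 / p) * volume.real Ω ^ (1 / p) := by
    rw [← Real.rpow_add hV]; simp
  refine le_of_mul_le_mul_right ?_ (Real.rpow_pos_of_pos hV (1 / p))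
  calc _ = s * ((1 - κ) * (volume.real Ω ^ (1 - 1 / p) * volume.real Ω ^ (1 / p))) := by ring
    _ = s * ((1 - κ) * volume.real Ω) := by rw [← h7]
    _ ≤ _ := h6
    _ = _ := by ring

end IsConvexDomain

end DistanceFunctions

/-! ### Lower bound for the unit ball -/

section Ball

variable {D : ℕ} {p : ℝ}

lemma isConvexDomain_ball : IsConvexDomain (Metric.ball (0 : EuclideanSpace ℝ (Fin D)) 1) :=
  ⟨⟨0, Metric.mem_ball_self one_pos⟩, Metric.isOpen_ball, Metric.isBounded_ball, convex_ball _ _⟩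

/-- Integration by parts against the radial vector field. -/
lemma IsTestFunction.integral_fderiv_apply_self {Ω : Set (EuclideanSpace ℝ (Fin D))}
    {φ : EuclideanSpace ℝ (Fin D) → ℝ} (h : IsTestFunction Ω φ) :
    ∫ x, fderiv ℝ φ x x = -(D * ∫ x, φ x) := by
  have hc := h.contDiff.continuous
  have hf := h.continuous_fderiv
  have hx : ∀ i : Fin D, Continuous fun x : EuclideanSpace ℝ (Fin D) => x i := fun i => by fun_prop
  have e : ∀ x : EuclideanSpace ℝ (Fin D), fderiv ℝ φ x x =
      ∑ i : Fin D, x i * fderiv ℝ φ x (EuclideanSpace.single i 1) := by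
    intro x
    have h1 := congrArg (fderiv ℝ φ x) ((EuclideanSpace.basisFun (Fin D) ℝ).sum_repr x)
    rw [map_sum] at h1
    rw [← h1]
    simp
  have hi : ∀ i : Fin D, Integrable fun x : EuclideanSpace ℝ (Fin D) =>
      x i * fderiv ℝ φ x (EuclideanSpace.single i 1) := fun i =>
    ((hx i).mul (hf.clm_apply continuous_const)).integrable_of_hasCompactSupport
      ((h.hasCompactSupport.fderiv_apply ℝ _).mul_left)
  have hpart : ∀ i : Fin D, ∫ x : EuclideanSpace ℝ (Fin D),
      x i * fderiv ℝ φ x (EuclideanSpace.single i 1) = -∫ x, φ x := by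
    intro i
    have hd : ∀ x, fderiv ℝ (fun x : EuclideanSpace ℝ (Fin D) => x i) x
        (EuclideanSpace.single i 1) = 1 := by
      intro x
      have : HasFDerivAt (fun x : EuclideanSpace ℝ (Fin D) => x i)
          (EuclideanSpace.proj (𝕜 := ℝ) i : EuclideanSpace ℝ (Fin D) →L[ℝ] ℝ) x :=
        (EuclideanSpace.proj (𝕜 := ℝ) i).hasFDerivAt
      rw [this.fderiv]; simp
    have hdiff : Differentiable ℝ fun x : EuclideanSpace ℝ (Fin D) => x i := by fun_prop
    rw [integral_mul_fderiv_eq_neg_fderiv_mul_of_integrable _ (hi i) _ (fun x _ => hdiff x)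
      fun x _ => h.differentiable x]
    · simp only [hd, one_mul]
    · simpa only [hd, one_mul] using h.integrable
    · exact ((hx i).mul hc).integrable_of_hasCompactSupport h.hasCompactSupport.mul_left
  simp only [e]
  rw [integral_finsetSum _ fun i _ => hi i]
  simp [hpart]

/-- The field `x` is a calibration: it has divergence `D` and length at most one on the ball, so `D
|∫ ψ| ≤ ∫ |∇ψ|`, and Hölder bounds the torsion constant. The average distance is at least `1 / (D +
1)` because the distance at the centre is at least one. -/
lemma le_scaledRigidity_ball (hD : 1 ≤ D) (hp : 1 < p) :
    (D : ℝ) / (D + 1) ≤ scaledRigidity p (Metric.ball (0 : EuclideanSpace ℝ (Fin D)) 1) := by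
  set B := Metric.ball (0 : EuclideanSpace ℝ (Fin D)) 1 with hB
  have hΩ : IsConvexDomain B := isConvexDomain_ball
  have : Fact (volume B < ⊤) := ⟨hΩ.volume_ne_top.lt_top⟩
  have hV := hΩ.volume_real_pos
  have hD0 : (0 : ℝ) < D := by exact_mod_cast hD
  have hδ : 1 ≤ (D + 1) * avgDist B :=
    (le_infDist_frontier hΩ.isOpen (hΩ.frontier_nonempty hD) subset_rfl).trans
      (hΩ.infDist_le_mul_avgDist hD (Metric.mem_ball_self one_pos))
  have hM : torsionConst p B ≤ volume.real B ^ (1 - 1 / p) / D := by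
    refine hΩ.torsionConst_le hD hp fun ψ hψ => ?_
    have h1 : |∫ x, fderiv ℝ ψ x x| ≤ ∫ x in B, ‖∇ ψ x‖ := by
      rw [← setIntegral_eq_integral_of_forall_compl_eq_zero (s := B) fun x hx => by
        rw [← inner_gradient_left, hψ.gradient_eq_zero_of_notMem hx, inner_zero_left], ← Real.norm_eq_abs]
      refine norm_integral_le_of_norm_le
        ((hψ.memLp_gradient (ENNReal.ofReal p)).integrable (one_le_ofReal_of_one_lt hp)).norm
        ((ae_restrict_iff' hΩ.isOpen.measurableSet).2 (Eventually.of_forall fun x hx => ?_))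
      rw [← inner_gradient_left]
      refine (norm_inner_le_norm _ _).trans (mul_le_of_le_one_right (norm_nonneg _) ?_)
      exact (mem_ball_zero_iff.1 hx).le
    have h2 := integral_norm_le_pNorm hp (hψ.memLp_gradient (Ω := B) (ENNReal.ofReal p))
    rw [measureReal_restrict_apply_univ] at h2
    rw [hψ.integral_fderiv_apply_self, abs_neg, abs_mul, abs_of_pos hD0, ← hψ.setIntegral_eq] at h1
    rw [div_mul_eq_mul_div, le_div_iff₀ hD0, mul_comm]
    exact h1.trans h2
  have hMpos := hΩ.torsionConst_pos hD hp
  rw [le_div_iff₀ hD0] at hM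
  rw [scaledRigidity, mul_div_assoc', div_le_div_iff₀ (by positivity) hMpos]
  calc D * torsionConst p B ≤ 1 * volume.real B ^ (1 - 1 / p) := by linarith
    _ ≤ (D + 1) * avgDist B * volume.real B ^ (1 - 1 / p) :=
        mul_le_mul_of_nonneg_right hδ (Real.rpow_nonneg hV.le _)
    _ = _ := by ring

end Ball

/-! ### Upper bound for thin boxes -/

section Box

variable {D : ℕ}

/-- The open box with half-side lengths `ℓ i`. -/
def box (ℓ : Fin D → ℝ) : Set (EuclideanSpace ℝ (Fin D)) := {x | ∀ i, |x i| < ℓ i}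

lemma isConvexDomain_box {ℓ : Fin D → ℝ} (hℓ : ∀ i, 0 < ℓ i) : IsConvexDomain (box ℓ) := by
  have e : box ℓ = ⋂ i, {x : EuclideanSpace ℝ (Fin D) | |x i| < ℓ i} := by
    ext x; simp [box]
  refine ⟨⟨0, fun i => by simpa using hℓ i⟩, ?_, ?_, ?_⟩
  · rw [e]
    exact isOpen_iInter_of_finite fun i => isOpen_lt (by fun_prop) continuous_const
  · refine (Metric.isBounded_ball (x := (0 : EuclideanSpace ℝ (Fin D)))
      (r := ∑ i, ℓ i + 1)).subset fun x hx => ?_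
    rw [mem_ball_zero_iff]
    have h1 : ‖x‖ ≤ ∑ i, |x i| := by
      conv_lhs => rw [← (EuclideanSpace.basisFun (Fin D) ℝ).sum_repr x]
      refine (norm_sum_le _ _).trans (Finset.sum_le_sum fun i _ => ?_)
      rw [norm_smul]; simp
    have h2 : ∑ i, |x i| ≤ ∑ i, ℓ i := Finset.sum_le_sum fun i _ => (hx i).le
    linarith
  · rw [e]
    refine convex_iInter fun i => ?_
    have h1 : {x : EuclideanSpace ℝ (Fin D) | |x i| < ℓ i} =
        (EuclideanSpace.proj (𝕜 := ℝ) i : EuclideanSpace ℝ (Fin D) →L[ℝ] ℝ) ⁻¹'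
          Set.Ioo (-ℓ i) (ℓ i) := by
      ext x; simp [abs_lt]
    rw [h1]
    exact (convex_Ioo _ _).is_linear_preimage
      (EuclideanSpace.proj (𝕜 := ℝ) i : EuclideanSpace ℝ (Fin D) →L[ℝ] ℝ).toLinearMap.isLinear

lemma integral_prod_coord (f : Fin D → ℝ → ℝ) :
    ∫ x : EuclideanSpace ℝ (Fin D), ∏ i, f i (x i) = ∏ i, ∫ t, f i t := by
  rw [← integral_fintype_prod_volume_eq_prod]
  exact (EuclideanSpace.volume_preserving_symm_measurableEquiv_toLp (Fin D)).integral_comp'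
    fun y : Fin D → ℝ => ∏ i, f i (y i)

lemma setIntegral_box_prod (ℓ : Fin D → ℝ) (f : Fin D → ℝ → ℝ) :
    ∫ x in box ℓ, ∏ i, f i (x i) = ∏ i, ∫ t in Set.Ioo (-ℓ i) (ℓ i), f i t := by
  have hm : MeasurableSet (box ℓ) := by
    have e : box ℓ = ⋂ i, {x : EuclideanSpace ℝ (Fin D) | |x i| < ℓ i} := by
      ext x; simp [box]
    rw [e]
    exact (isOpen_iInter_of_finite fun i => isOpen_lt (by fun_prop)
      continuous_const).measurableSet
  rw [← integral_indicator hm]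
  simp only [← integral_indicator measurableSet_Ioo]
  rw [← integral_prod_coord]
  refine integral_congr_ae (Eventually.of_forall fun x => ?_)
  simp only
  by_cases hx : x ∈ box ℓ
  · rw [Set.indicator_of_mem hx]
    refine Finset.prod_congr rfl fun i _ => ?_
    have hxi : x i ∈ Set.Ioo (-ℓ i) (ℓ i) := abs_lt.1 (hx i)
    rw [Set.indicator_of_mem hxi]
  · rw [Set.indicator_of_notMem hx]
    obtain ⟨i, hi⟩ := not_forall.1 hx
    refine (Finset.prod_eq_zero (Finset.mem_univ i) ?_).symm
    have hxi : x i ∉ Set.Ioo (-ℓ i) (ℓ i) := fun h => hi (abs_lt.2 h)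
    rw [Set.indicator_of_notMem hxi]

lemma volume_real_box {ℓ : Fin D → ℝ} (hℓ : ∀ i, 0 ≤ ℓ i) :
    volume.real (box ℓ) = ∏ i, (2 * ℓ i) := by
  have h := setIntegral_box_prod ℓ fun _ _ => 1
  simp only [Finset.prod_const_one, integral_const, smul_eq_mul, mul_one,
    measureReal_restrict_apply_univ] at h
  rw [h]
  refine Finset.prod_congr rfl fun i _ => ?_
  rw [Real.volume_real_Ioo_of_le (by linarith [hℓ i])]
  ring

/-- Moving `x` along the `i`-th axis towards the nearer face leaves the box after length `ℓ i - |x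
i|`. -/
lemma infDist_box_le {ℓ : Fin D → ℝ} (hℓ : ∀ i, 0 < ℓ i) (i : Fin D)
    {x : EuclideanSpace ℝ (Fin D)} (hx : x ∈ box ℓ) :
    Metric.infDist x (frontier (box ℓ)) ≤ ℓ i - |x i| := by
  have hD : 1 ≤ D := (Nat.succ_le_iff.2 (Fin.pos i))
  have hΩ := isConvexDomain_box hℓ
  rw [← hΩ.infDist_compl_eq hD hx]
  set σ : ℝ := if 0 ≤ x i then 1 else -1 with hσ
  have hσx : σ * |x i| = x i := by
    rw [hσ]
    split_ifs with h
    · rw [abs_of_nonneg h, one_mul]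
    · rw [abs_of_neg (not_le.1 h)]; ring
  have hσ1 : |σ| = 1 := by
    rw [hσ]; split_ifs <;> simp
  have hxi := hx i
  have hy : x + EuclideanSpace.single i (σ * (ℓ i - |x i|)) ∈ (box ℓ)ᶜ := by
    intro h
    have h1 := h i
    have h2 : (x + EuclideanSpace.single i (σ * (ℓ i - |x i|))) i = σ * ℓ i := by
      simp only [PiLp.add_apply, PiLp.single_apply, if_true]
      linarith
    rw [h2, abs_mul, hσ1, abs_of_pos (hℓ i)] at h1
    linarith
  refine (Metric.infDist_le_dist_of_mem hy).trans (le_of_eq ?_)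
  rw [dist_self_add_right, PiLp.norm_single, norm_mul, Real.norm_eq_abs, hσ1, one_mul,
    Real.norm_of_nonneg (by linarith)]

lemma le_infDist_box {ℓ : Fin D → ℝ} (hℓ : ∀ i, 0 < ℓ i) (hD : 1 ≤ D) {s : ℝ}
    {x : EuclideanSpace ℝ (Fin D)} (hx : x ∈ box fun i => ℓ i - s) :
    s ≤ Metric.infDist x (frontier (box ℓ)) := by
  have hΩ := isConvexDomain_box hℓ
  refine le_infDist_frontier hΩ.isOpen (hΩ.frontier_nonempty hD) fun y hy i => ?_
  have h1 : |y i - x i| ≤ ‖y - x‖ := PiLp.norm_apply_le (y - x) i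
  have h2 : ‖y - x‖ < s := by rwa [← dist_eq_norm]
  have h3 := hx i
  have h4 : |y i| ≤ |x i| + |y i - x i| := by
    have := abs_add_le (x i) (y i - x i)
    rwa [add_sub_cancel] at this
  linarith

lemma setIntegral_Ioo_sub_abs {l : ℝ} (hl : 0 < l) :
    ∫ t in Set.Ioo (-l) l, (l - |t|) = l / 2 * (2 * l) := by
  rw [← integral_Ioc_eq_integral_Ioo, ← intervalIntegral.integral_of_le (by linarith),
    ← intervalIntegral.integral_add_adjacent_intervals (b := 0)
      (Continuous.intervalIntegrable (by fun_prop) _ _)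
      (Continuous.intervalIntegrable (by fun_prop) _ _)]
  have h1 : ∫ t in (-l)..0, (l - |t|) = ∫ t in (-l)..0, (l + t) :=
    intervalIntegral.integral_congr fun t ht => by
      rw [Set.uIcc_of_le (by linarith)] at ht
      rw [abs_of_nonpos ht.2]; ring
  have h2 : ∫ t in (0 : ℝ)..l, (l - |t|) = ∫ t in (0 : ℝ)..l, (l - t) :=
    intervalIntegral.integral_congr fun t ht => by
      rw [Set.uIcc_of_le hl.le] at ht
      rw [abs_of_nonneg ht.1]
  rw [h1, h2, intervalIntegral.integral_add (by simp) (by simp),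
    intervalIntegral.integral_sub (by simp) (by simp)]
  simp only [intervalIntegral.integral_const, integral_id, smul_eq_mul]
  ring

lemma avgDist_box_le {ℓ : Fin D → ℝ} (hℓ : ∀ i, 0 < ℓ i) (i : Fin D) :
    avgDist (box ℓ) ≤ ℓ i / 2 := by
  have hΩ := isConvexDomain_box hℓ
  have hV := hΩ.volume_real_pos
  rw [avgDist, inv_mul_le_iff₀ hV]
  set f : Fin D → ℝ → ℝ := fun j t => if j = i then ℓ i - |t| else 1 with hf
  have hprod : ∀ x : EuclideanSpace ℝ (Fin D), ∏ j, f j (x j) = ℓ i - |x i| := by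
    intro x
    rw [Finset.prod_eq_single i (fun j _ hj => by simp [hf, hj]) (by simp)]
    simp [hf]
  have h1 : ∫ x in box ℓ, Metric.infDist x (frontier (box ℓ)) ≤ ∫ x in box ℓ, ∏ j, f j (x j) := by
    refine setIntegral_mono_on (hΩ.integrableOn_of_continuous (Metric.continuous_infDist_pt _))
      ?_ hΩ.isOpen.measurableSet fun x hx => ?_
    · simp only [hprod]
      exact hΩ.integrableOn_of_continuous (by fun_prop)
    · rw [hprod]; exact infDist_box_le hℓ i hx
  refine h1.trans (le_of_eq ?_)
  rw [setIntegral_box_prod, volume_real_box fun j => (hℓ j).le,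
    ← Finset.mul_prod_erase _ _ (Finset.mem_univ i), ← Finset.mul_prod_erase _ (fun j => 2 * ℓ j)
      (Finset.mem_univ i)]
  have h2 : ∏ j ∈ Finset.univ.erase i, ∫ t in Set.Ioo (-ℓ j) (ℓ j), f j t =
      ∏ j ∈ Finset.univ.erase i, 2 * ℓ j := by
    refine Finset.prod_congr rfl fun j hj => ?_
    simp only [hf, if_neg (Finset.ne_of_mem_erase hj), integral_const, smul_eq_mul, mul_one,
      measureReal_restrict_apply_univ]
    rw [Real.volume_real_Ioo_of_le (by linarith [hℓ j])]
    ring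
  rw [h2]
  simp only [hf, if_true]
  rw [setIntegral_Ioo_sub_abs (hℓ i)]
  ring

/-- The Weierstrass product inequality. -/
lemma one_sub_sum_le_prod_one_sub {ι : Type*} (S : Finset ι) (a : ι → ℝ) (h0 : ∀ i, 0 ≤ a i)
    (h1 : ∀ i, a i ≤ 1) : 1 - ∑ i ∈ S, a i ≤ ∏ i ∈ S, (1 - a i) := by
  classical
  induction S using Finset.induction_on with
  | empty => simp
  | insert i S hi ih =>
    rw [Finset.sum_insert hi, Finset.prod_insert hi]
    have h2 := mul_le_mul_of_nonneg_left ih (sub_nonneg.2 (h1 i))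
    have h3 : 0 ≤ a i * ∑ j ∈ S, a j := mul_nonneg (h0 i) (Finset.sum_nonneg fun j _ => h0 j)
    linarith

/-- The level set contains the box with all half-sides shortened by `s`, whose volume fraction is `∏
(1 - s / ℓ i)`. -/
lemma one_sub_mul_volume_box_le {ℓ : Fin D → ℝ} (hℓ : ∀ i, 0 < ℓ i) (hD : 1 ≤ D) {s : ℝ}
    (hs0 : 0 ≤ s) (hs : ∀ i, s ≤ ℓ i) :
    (1 - ∑ i, s / ℓ i) * volume.real (box ℓ) ≤
      volume.real (box ℓ ∩ {x | s ≤ Metric.infDist x (frontier (box ℓ))}) := by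
  have hΩ := isConvexDomain_box hℓ
  have h1 : volume.real (box fun i => ℓ i - s) ≤
      volume.real (box ℓ ∩ {x | s ≤ Metric.infDist x (frontier (box ℓ))}) := by
    refine measureReal_mono (fun x hx => ⟨fun i => ?_, le_infDist_box hℓ hD hx⟩)
      ((measure_mono Set.inter_subset_left).trans_lt hΩ.volume_ne_top.lt_top).ne
    have := hx i
    linarith
  refine le_trans ?_ h1
  rw [volume_real_box fun i => sub_nonneg.2 (hs i), volume_real_box fun i => (hℓ i).le]
  have h2 : ∏ i, 2 * (ℓ i - s) = (∏ i, (1 - s / ℓ i)) * ∏ i, 2 * ℓ i := by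
    rw [← Finset.prod_mul_distrib]
    refine Finset.prod_congr rfl fun i _ => ?_
    have := (hℓ i).ne'
    field_simp
  rw [h2]
  refine mul_le_mul_of_nonneg_right (one_sub_sum_le_prod_one_sub _ _
    (fun i => div_nonneg hs0 (hℓ i).le) fun i => (div_le_one (hℓ i)).2 (hs i)) ?_
  exact Finset.prod_nonneg fun i _ => by linarith [hℓ i]

/-- Thin boxes have a small scaled rigidity when `p` is close to `1`. -/
lemma exists_scaledRigidity_lt (hD : 1 ≤ D) :
    ∃ Ω : Set (EuclideanSpace ℝ (Fin D)), IsConvexDomain Ω ∧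
      scaledRigidity (20 / 19) Ω < 2 / 3 := by
  have hD0 : (1 : ℝ) ≤ D := by exact_mod_cast hD
  set i₀ : Fin D := ⟨0, hD⟩ with hi₀
  -- With `s = 1 / 20` the short side contributes `1 / 20` to the layer fraction, and the long ones
  -- together at most `1 / 2000`, whence `κ = 101 / 2000`.
  set ℓ : Fin D → ℝ := fun i => if i = i₀ then 1 else 100 * D with hℓdef
  have hℓ1 : ∀ i, 1 ≤ ℓ i := fun i => by
    simp only [hℓdef]; split_ifs <;> linarith
  have hℓ : ∀ i, 0 < ℓ i := fun i => one_pos.trans_le (hℓ1 i)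
  have hΩ := isConvexDomain_box hℓ
  have hsum : ∑ i, (1 / 20 : ℝ) / ℓ i ≤ 101 / 2000 := by
    have h1 : ∀ i, (1 / 20 : ℝ) / ℓ i ≤ (if i = i₀ then 1 / 20 else 0) + 1 / (2000 * D) := by
      intro i
      simp only [hℓdef]
      split_ifs
      · have : (0 : ℝ) ≤ 1 / (2000 * D) := by positivity
        linarith
      · rw [zero_add, div_div]
        exact le_of_eq (by ring)
    refine (Finset.sum_le_sum fun i _ => h1 i).trans (le_of_eq ?_)
    rw [Finset.sum_add_distrib, Finset.sum_ite_eq' Finset.univ i₀, Finset.sum_const,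
      Finset.card_univ, Fintype.card_fin, nsmul_eq_mul]
    simp only [Finset.mem_univ, if_true]
    field_simp
    norm_num
  have hδ : avgDist (box ℓ) ≤ 1 / 2 := by
    have := avgDist_box_le hℓ i₀
    simpa [hℓdef] using this
  have hvol := one_sub_mul_volume_box_le hℓ hD (s := 1 / 20) (by norm_num)
    fun i => le_trans (by norm_num) (hℓ1 i)
  have hκ : (1 - 101 / 2000 : ℝ) * volume.real (box ℓ) ≤
      volume.real (box ℓ ∩ {x | 1 / 20 ≤ Metric.infDist x (frontier (box ℓ))}) :=
    le_trans (mul_le_mul_of_nonneg_right (by linarith) hΩ.volume_real_pos.le) hvol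
  have hmain := hΩ.scaledRigidity_le_of_volume_level hD (p := 20 / 19) (by norm_num)
    (s := 1 / 20) (κ := 101 / 2000) (by norm_num) (by norm_num) (by norm_num) hκ
  -- The exponent is `19 / 20`, so raising to the 20th power leaves a comparison of rationals.
  have hpow : (101 / 2000 : ℝ) ^ (1 / (20 / 19) : ℝ) ≤ 6 / 5 * (101 / 2000) := by
    have h2 : ((101 / 2000 : ℝ) ^ (1 / (20 / 19) : ℝ)) ^ 20 = (101 / 2000) ^ 19 := by
      rw [← Real.rpow_natCast, ← Real.rpow_mul (by norm_num), ← Real.rpow_natCast]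
      congr 1
      norm_num
    refine le_of_pow_le_pow_left₀ (n := 20) (by norm_num) (by norm_num) ?_
    rw [h2]
    norm_num
  refine ⟨box ℓ, hΩ, hmain.trans_lt ?_⟩
  have hδ0 := hΩ.avgDist_pos hD
  have h3 : (101 / 2000 : ℝ) ^ (1 / (20 / 19) : ℝ) / (1 / 20 * (1 - 101 / 2000)) ≤ 1.28 := by
    rw [div_le_iff₀ (by norm_num)]
    refine hpow.trans ?_
    norm_num
  calc _ ≤ 1 / 2 * 1.28 := mul_le_mul hδ h3 (by positivity) (by norm_num)
    _ < _ := by norm_num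

end Box

/-! ### Quotients of scaled rigidities -/

section Quotients

/-- The set of quotients of scaled rigidities of two convex domains with the same exponent. -/
def rigidityQuotients (D : ℕ) : Set ℝ :=
  {t | ∃ (p : ℝ) (Ω Ω' : Set (EuclideanSpace ℝ (Fin D))), 1 < p ∧ IsConvexDomain Ω ∧
    IsConvexDomain Ω' ∧ t = scaledRigidity p Ω / scaledRigidity p Ω'}

variable {D : ℕ}

lemma one_div_le_of_mem_rigidityQuotients (hD : 1 ≤ D) {t : ℝ} (ht : t ∈ rigidityQuotients D) :
    1 / ((D : ℝ) + 1) ≤ t := by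
  obtain ⟨p, Ω, Ω', hp, hΩ, hΩ', rfl⟩ := ht
  rw [le_div_iff₀ (hΩ'.scaledRigidity_pos hD hp)]
  refine le_trans ?_ (hΩ.one_div_le_scaledRigidity hD hp)
  exact mul_le_of_le_one_right (by positivity) (hΩ'.scaledRigidity_le_one hD hp)

/-- Thin box over ball. The hypothesis `2 ≤ D` is what makes `D / (D + 1) ≥ 2 / 3`. -/
lemma exists_mem_rigidityQuotients_lt_one (hD : 2 ≤ D) : ∃ t ∈ rigidityQuotients D, t < 1 := by
  have hD1 : 1 ≤ D := by omega
  have hp : (1 : ℝ) < 20 / 19 := by norm_num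
  obtain ⟨Ω, hΩ, hlt⟩ := exists_scaledRigidity_lt hD1
  have hB := le_scaledRigidity_ball (D := D) hD1 hp
  have h2 : (2 / 3 : ℝ) ≤ D / (D + 1) := by
    have : (2 : ℝ) ≤ D := by exact_mod_cast hD
    rw [div_le_div_iff₀ (by norm_num) (by positivity)]
    linarith
  refine ⟨_, ⟨20 / 19, Ω, _, hp, hΩ, isConvexDomain_ball, rfl⟩, ?_⟩
  rw [div_lt_one (isConvexDomain_ball.scaledRigidity_pos hD1 hp)]
  linarith

/-- Dilate by `r / δ(Ω)`, which leaves the scaled rigidity unchanged. -/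
lemma exists_mem_domainsWithAvgDist (hD : 1 ≤ D) {p : ℝ} (hp : 1 < p)
    {Ω : Set (EuclideanSpace ℝ (Fin D))} (hΩ : IsConvexDomain Ω) {r : ℝ} (hr : 0 < r) :
    ∃ Ω' ∈ domainsWithAvgDist D r,
      normalizedRigidity p Ω' = (scaledRigidity p Ω / r) ^ p := by
  have hc : 0 < r / avgDist Ω := div_pos hr (hΩ.avgDist_pos hD)
  have hr' : avgDist ((r / avgDist Ω) • Ω) = r := by
    rw [IsConvexDomain.avgDist_smul hc, div_mul_cancel₀ _ (hΩ.avgDist_pos hD).ne']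
  refine ⟨(r / avgDist Ω) • Ω, ⟨hΩ.smul hc, hr'⟩, ?_⟩
  rw [(hΩ.smul hc).normalizedRigidity_eq hD hp, hr', hΩ.scaledRigidity_smul hD hp hc]

end Quotients

end PTorsion

/-! ### The main theorem -/

open PTorsion

theorem mainTheorem4 (D : ℕ) (hD : 2 ≤ D) :
    ∃ γ : ℝ, 2 / ((D : ℝ) * ((D : ℝ) + 1)) ≤ γ ∧ γ < 1 ∧
      ∀ a b : ℝ, 0 < a → a < b →
        (γ * b < a →
          ∃ q : ℝ, 1 < q ∧
            ∃ Ωa ∈ PTorsion.domainsWithAvgDist D a, ∃ Ωb ∈ PTorsion.domainsWithAvgDist D b,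
              PTorsion.normalizedRigidity q Ωa < PTorsion.normalizedRigidity q Ωb) ∧
        (a ≤ γ * b →
          ∀ Ωa ∈ PTorsion.domainsWithAvgDist D a, ∀ Ωb ∈ PTorsion.domainsWithAvgDist D b,
            ∀ p : ℝ, 1 < p →
              PTorsion.normalizedRigidity p Ωb ≤ PTorsion.normalizedRigidity p Ωa) ∧
        (a < γ * b →
          ∀ Ωa ∈ PTorsion.domainsWithAvgDist D a, ∀ Ωb ∈ PTorsion.domainsWithAvgDist D b,
            ∀ p : ℝ, 1 < p →
              PTorsion.normalizedRigidity p Ωb < PTorsion.normalizedRigidity p Ωa) := by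
  have hD1 : 1 ≤ D := by omega
  have hD2 : (2 : ℝ) ≤ D := by exact_mod_cast hD
  obtain ⟨t, ht, ht1⟩ := exists_mem_rigidityQuotients_lt_one hD
  have hbdd : BddBelow (rigidityQuotients D) :=
    ⟨_, fun _ h => one_div_le_of_mem_rigidityQuotients hD1 h⟩
  refine ⟨sInf (rigidityQuotients D), ?_, (csInf_le hbdd ht).trans_lt ht1,
    fun a b ha hab => ⟨fun h => ?_, ?_, ?_⟩⟩
  · refine le_trans ?_ (le_csInf ⟨t, ht⟩ fun _ h => one_div_le_of_mem_rigidityQuotients hD1 h)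
    rw [div_le_div_iff₀ (by positivity) (by positivity)]
    have : 0 ≤ ((D : ℝ) - 2) * (D + 1) := mul_nonneg (by linarith) (by linarith)
    linarith
  · have hb : 0 < b := ha.trans hab
    -- Some quotient lies below `a / b`; dilating its numerator domain to `a` and its denominator
    -- domain to `b` violates the monotonicity at that `p`.
    obtain ⟨_, ⟨p, Ω, Ω', hp, hΩ, hΩ', rfl⟩, hlt⟩ :=
      exists_lt_of_csInf_lt ⟨t, ht⟩ ((lt_div_iff₀ hb).2 h)
    obtain ⟨Ωa, hΩa, ea⟩ := exists_mem_domainsWithAvgDist hD1 hp hΩ ha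
    obtain ⟨Ωb, hΩb, eb⟩ := exists_mem_domainsWithAvgDist hD1 hp hΩ' hb
    refine ⟨p, hp, Ωa, hΩa, Ωb, hΩb, ?_⟩
    rw [ea, eb]
    have h0 := hΩ.scaledRigidity_pos hD1 hp
    have h0' := hΩ'.scaledRigidity_pos hD1 hp
    refine Real.rpow_lt_rpow (by positivity) ?_ (by linarith)
    rw [div_lt_div_iff₀ h0' hb] at hlt
    rw [div_lt_div_iff₀ ha hb]
    linarith
  -- Both halves of (ii) rest on the infimum being a lower bound for the quotient of the two given
  -- domains; strictness comes only from `a < γ b`.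
  all_goals
    rintro h Ωa ⟨hΩa, ea⟩ Ωb ⟨hΩb, eb⟩ p hp
    have hb : 0 < b := ha.trans hab
    have h0 := hΩa.scaledRigidity_pos hD1 hp
    have h0' := hΩb.scaledRigidity_pos hD1 hp
    have hq : sInf (rigidityQuotients D) ≤ scaledRigidity p Ωa / scaledRigidity p Ωb :=
      csInf_le hbdd ⟨p, Ωa, Ωb, hp, hΩa, hΩb, rfl⟩
    have hq' := (le_div_iff₀ h0').1 hq
    have hqb := mul_le_mul_of_nonneg_right hq' hb.le
    rw [hΩa.normalizedRigidity_eq hD1 hp, hΩb.normalizedRigidity_eq hD1 hp, ea, eb]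
  · refine Real.rpow_le_rpow (by positivity) ?_ (by linarith)
    rw [div_le_div_iff₀ hb ha]
    have := mul_le_mul_of_nonneg_left h h0'.le
    linarith
  · refine Real.rpow_lt_rpow (by positivity) ?_ (by linarith)
    rw [div_lt_div_iff₀ hb ha]
    have := mul_lt_mul_of_pos_left h h0'
    linarith
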